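/- **Definitions.** Functions and hypersurfaces are considered as germs. For a smooth ($C^\infty$) real-valued function $F$ near $0\in\mathbb C^m$ put $C_{\alpha\beta}=\frac1{\alpha!\beta!}D^\alpha\bar D^\beta F(0)$, where $D^\alpha=\partial^{|\alpha|}/\partial z^\alpha$, $\bar D^\beta=\partial^{|\beta|}/\partial\bar z^\beta$ and $\alpha,\beta\in\mathbb Z_{\ge0}^m$. The Newton polyhedron $\mathcal N_+(F)$ is the convex hull of $\bigcup\{\alpha+\beta+\mathbb R_{\ge0}^m : C_{\alpha\beta}\ne0\}$; $F$ is flat if $\mathcal N_+(F)=\emptyset$. A face of $\mathcal N_+(F)$ is a set $\kappa=\{\xi\in\mathcal N_+(F):\langle a,\xi\rangle=l\}$ with $a\in\mathbb Z^m$, $l\in\mathbb Z$ and $\langle a,\xi\rangle\ge l$ on $\mathcal N_+(F)$; then $a$ is said to determine $\kappa$. The Newton diagram $\mathcal N(F)$ is the union of the bounded faces. For a bounded face $\kappa$ let $F_\kappa=\sum_{\alpha+\beta\in\kappa}C_{\alpha\beta}z^\alpha\bar z^\beta$; the principal part of $F$ is $F_0=\sum_{\alpha+\beta\in\mathcal N(F)}C_{\alpha\beta}z^\alpha\bar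 z^\beta$. $F$ is nondegenerate if for every nonempty bounded face $\kappa$, every $a\in\mathbb Z_{>0}^m$ determining $\kappa$ and every $c\in(\mathbb C\setminus\{0\})^m$, the function $t\mapsto F_\kappa(c_1t^{a_1},\dots,c_mt^{a_m})$, $t\in\mathbb C$, is not identically zero. Let $\rho_j(F)=\min\{t>0: t\,\mathbf e_j\in\mathcal N_+(F)\}$, where $\min\emptyset=\infty$. Let $M$ be a smooth real hypersurface in $\mathbb C^{n+1}$ and $p\in M$. A holomorphic coordinate around $p$, with $p=0$ in it, is canonical for $M$ at $p$ if on it some local defining function for $M$ (smooth, real-valued, with nonzero differential) is nondegenerate. A holomorphic coordinate $(z,w)=(z_1,\dots,z_n,w)$ around $p$, with $p=0$ in it, is normalized for $M$ at $p$ with order $N$ if on it $M$ has near the origin a local defining function of the form $$r=\operatorname{Re}(w)+F(z,\bar z)+R_1(z,\bar z)\operatorname{Im}(w)+R_2(z,w,\bar z,\bar w),$$ where $F,R_1,R_2$ are smooth near the origin, $F(0)=0$, $\nabla F(0)=0$, the Taylor coefficients of $F$ satisfy $C_{\alpha0}=C_{0\alpha}=0$ whenever $|\alpha|\le N$, $\rho_j(F)=\rho_j(r)\ge2$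 for $j=1,\dots,n$, and $|R_2|\le C|w|^2$ near the origin for some constant $C>0$. **Theorem 13.1.** Let $(z,w)$ be a normalized coordinate for $M$ at $p$ with some order $N$, on which $M$ is locally given by $r$ as above. Suppose that $F$ is nonflat and plurisubharmonic near the origin, and that its principal part $F_0$ is invariant under the rotation, that is, $F_0(e^{i\theta_1}z_1,\dots,e^{i\theta_n}z_n)=F_0(z)$ for all $\theta\in\mathbb R^n$ and $z\in\mathbb C^n$. Then the coordinate $(z,w)$ is canonical for $M$ at $p$. -/

import Mathlib

open Set Filter Topology
open scoped ContDiff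

noncomputable section

namespace NewtonType

/-- Wirtinger derivative `∂f/∂z_j = (1/2) (∂f/∂x_j - i ∂f/∂y_j)`. -/
def wirtinger {m : ℕ} (j : Fin m) (f : (Fin m → ℂ) → ℂ) : (Fin m → ℂ) → ℂ := fun z =>
  (1 / 2 : ℂ) * (fderiv ℝ f z (Pi.single j 1) - Complex.I * fderiv ℝ f z (Pi.single j Complex.I))

/-- Conjugate Wirtinger derivative `∂f/∂z̄_j = (1/2) (∂f/∂x_j + i ∂f/∂y_j)`. -/
def wirtingerBar {m : ℕ} (j : Fin m) (f : (Fin m → ℂ) → ℂ) : (Fin m → ℂ) → ℂ := fun z =>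
  (1 / 2 : ℂ) * (fderiv ℝ f z (Pi.single j 1) + Complex.I * fderiv ℝ f z (Pi.single j Complex.I))

/-- `D^α = ∂^{|α|} / ∂z_1^{α_1} ⋯ ∂z_m^{α_m}`. -/
def iterWirtinger {m : ℕ} (α : Fin m → ℕ) (f : (Fin m → ℂ) → ℂ) : (Fin m → ℂ) → ℂ :=
  (List.finRange m).foldr (fun j g => (wirtinger j)^[α j] g) f

/-- `D̄^β = ∂^{|β|} / ∂z̄_1^{β_1} ⋯ ∂z̄_m^{β_m}`. -/
def iterWirtingerBar {m : ℕ} (β : Fin m → ℕ) (f : (Fin m → ℂ) → ℂ) : (Fin m → ℂ) → ℂ :=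
  (List.finRange m).foldr (fun j g => (wirtingerBar j)^[β j] g) f

/-- The Taylor coefficient `C_{αβ} = D^α D̄^β F (0) / (α! β!)` of a real-valued `F`. -/
def taylorCoeff {m : ℕ} (F : (Fin m → ℂ) → ℝ) (α β : Fin m → ℕ) : ℂ :=
  ((∏ j, ((α j).factorial : ℂ)) * ∏ j, ((β j).factorial : ℂ))⁻¹ *
    iterWirtinger α (iterWirtingerBar β (fun z => (F z : ℂ))) 0

/-- The exponent `α + β`, as a point of `ℝ^m`. -/
def exponent {m : ℕ} (α β : Fin m → ℕ) : Fin m → ℝ := fun j => ((α j + β j : ℕ) : ℝ)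

/-- The support `S(F) = {α + β : C_{αβ} ≠ 0}`. -/
def support {m : ℕ} (F : (Fin m → ℂ) → ℝ) : Set (Fin m → ℝ) :=
  {s | ∃ α β : Fin m → ℕ, taylorCoeff F α β ≠ 0 ∧ s = exponent α β}

/-- The Newton polyhedron `N_+(F)`: the convex hull of `⋃_{s ∈ S(F)} (s + ℝ_{≥0}^m)`. -/
def newtonPolyhedron {m : ℕ} (F : (Fin m → ℂ) → ℝ) : Set (Fin m → ℝ) :=
  convexHull ℝ (⋃ s ∈ support F, {ξ : Fin m → ℝ | ∀ j, s j ≤ ξ j})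

/-- `F` is flat when its Newton polyhedron is empty. -/
def IsFlat {m : ℕ} (F : (Fin m → ℂ) → ℝ) : Prop := newtonPolyhedron F = ∅

/-- `κ` is the face of `P` cut out by the valid pair `(a, l)`:
`P ⊆ {⟨a, ξ⟩ ≥ l}` and `κ = P ∩ {⟨a, ξ⟩ = l}`. -/
def CutsOut {m : ℕ} (P : Set (Fin m → ℝ)) (a : Fin m → ℤ) (l : ℤ) (κ : Set (Fin m → ℝ)) : Prop :=
  (∀ ξ ∈ P, (l : ℝ) ≤ ∑ j, (a j : ℝ) * ξ j) ∧ κ = {ξ ∈ P | ∑ j, (a j : ℝ) * ξ j = l}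

/-- Faces of `P` (the empty set and `P` itself included). -/
def IsFace {m : ℕ} (P κ : Set (Fin m → ℝ)) : Prop := ∃ a l, CutsOut P a l κ

/-- The Newton diagram `N(F)`: the union of the bounded faces of `N_+(F)`. -/
def newtonDiagram {m : ℕ} (F : (Fin m → ℂ) → ℝ) : Set (Fin m → ℝ) :=
  {ξ | ∃ κ, IsFace (newtonPolyhedron F) κ ∧ Bornology.IsBounded κ ∧ ξ ∈ κ}

/-- The polynomial `∑_{α + β ∈ A} C_{αβ} z^α z̄^β`. It is used only for bounded sets `A`
(bounded faces and the Newton diagram), so that the sum is finite. -/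
def part {m : ℕ} (F : (Fin m → ℂ) → ℝ) (A : Set (Fin m → ℝ)) (z : Fin m → ℂ) : ℂ :=
  ∑ᶠ (q : (Fin m → ℕ) × (Fin m → ℕ)) (_ : exponent q.1 q.2 ∈ A),
    taylorCoeff F q.1 q.2 * (∏ j, z j ^ q.1 j) * ∏ j, (starRingEnd ℂ (z j)) ^ q.2 j

/-- The principal part `F_0`. -/
def principalPart {m : ℕ} (F : (Fin m → ℂ) → ℝ) : (Fin m → ℂ) → ℂ :=
  part F (newtonDiagram F)

/-- `F` is nondegenerate: for every nonempty bounded face `κ` of `N_+(F)`, the polynomial `F_κ` does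
not vanish identically on any curve `t ↦ (c_1 t^{a_1}, …, c_m t^{a_m})` with `c ∈ (ℂ^*)^m` and
with `a` a vector of positive integers that determines `κ`. -/
def IsNondegenerate {m : ℕ} (F : (Fin m → ℂ) → ℝ) : Prop :=
  ∀ κ : Set (Fin m → ℝ), IsFace (newtonPolyhedron F) κ → Bornology.IsBounded κ → κ.Nonempty →
    ∀ (c : Fin m → ℂ) (a : Fin m → ℕ), (∀ j, c j ≠ 0) → (∀ j, 1 ≤ a j) →
      (∃ l : ℤ, CutsOut (newtonPolyhedron F) (fun j => (a j : ℤ)) l κ) →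
        ∃ t : ℂ, part F κ (fun j => c j * t ^ a j) ≠ 0

/-- `ρ_j(F) = min {t > 0 : t e_j ∈ N_+(F)}`, which is `∞` if `N_+(F)` does not meet the axis. -/
def rho {m : ℕ} (F : (Fin m → ℂ) → ℝ) (j : Fin m) : EReal :=
  sInf ((fun t : ℝ => (t : EReal)) '' {t : ℝ | 0 < t ∧ Pi.single j t ∈ newtonPolyhedron F})

/-- `f` is (the germ of) a `C^∞` function at `x`: it is `C^∞` on a neighbourhood of `x`. -/
def SmoothGerm {E : Type*} [NormedAddCommGroup E] [NormedSpace ℝ E] (f : E → ℝ) (x : E) : Prop :=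
  ∃ U : Set E, IsOpen U ∧ x ∈ U ∧ ContDiffOn ℝ ∞ f U

/-- `r` is a smooth local defining function near `x` for the real hypersurface `S`. -/
def IsDefiningFunctionAt {m : ℕ} (S : Set (Fin m → ℂ)) (x : Fin m → ℂ)
    (r : (Fin m → ℂ) → ℝ) : Prop :=
  SmoothGerm r x ∧ r x = 0 ∧ fderiv ℝ r x ≠ 0 ∧ ∀ᶠ ζ in 𝓝 x, ζ ∈ S ↔ r ζ = 0

/-- `S` is a smooth real hypersurface near its point `x`. -/
def IsRealHypersurfaceAt {m : ℕ} (S : Set (Fin m → ℂ)) (x : Fin m → ℂ) : Prop :=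
  ∃ r, IsDefiningFunctionAt S x r

/-- A holomorphic coordinate around `p` with `p = 0`: a biholomorphic map from a neighbourhood of
`p` onto a neighbourhood of `0` that sends `p` to `0`. -/
structure HolomorphicCoordinate {m : ℕ} (p : Fin m → ℂ) where
  chart : OpenPartialHomeomorph (Fin m → ℂ) (Fin m → ℂ)
  mem_source : p ∈ chart.source
  map_point : chart p = 0
  holomorphic : DifferentiableOn ℂ chart chart.source
  holomorphic_symm : DifferentiableOn ℂ chart.symm chart.target

/-- `r` is a local defining function for `M` near `p` on the given coordinate, that is, for the
image of `M` near the origin of the coordinate space. -/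
def IsDefiningFunctionOn {m : ℕ} {p : Fin m → ℂ} (M : Set (Fin m → ℂ))
    (Z : HolomorphicCoordinate p) (r : (Fin m → ℂ) → ℝ) : Prop :=
  IsDefiningFunctionAt (Z.chart.symm ⁻¹' M) 0 r

/-- The coordinate is canonical for `M` at `p`: some local defining function for `M` is
nondegenerate on it. -/
def IsCanonical {m : ℕ} {p : Fin m → ℂ} (M : Set (Fin m → ℂ))
    (Z : HolomorphicCoordinate p) : Prop :=
  ∃ r, IsDefiningFunctionOn M Z r ∧ IsNondegenerate r

/-- The coordinate `(z, w)`, `z = (ζ_1, …, ζ_n)`, `w = ζ_{n+1}`, is normalized for `M` at `p` with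
order `N`, through the local defining function
`r = Re w + F(z) + R₁(z) Im w + R₂(z, w)`. -/
structure IsNormalized {n : ℕ} {p : Fin (n + 1) → ℂ} (M : Set (Fin (n + 1) → ℂ))
    (Z : HolomorphicCoordinate p) (N : ℕ) (r : (Fin (n + 1) → ℂ) → ℝ)
    (F R₁ : (Fin n → ℂ) → ℝ) (R₂ : (Fin (n + 1) → ℂ) → ℝ) : Prop where
  defining : IsDefiningFunctionOn M Z r
  expression : ∀ᶠ ζ : Fin (n + 1) → ℂ in 𝓝 0,
    r ζ = (ζ (Fin.last n)).re + F (Fin.init ζ) + R₁ (Fin.init ζ) * (ζ (Fin.last n)).im + R₂ ζ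
  smooth_F : SmoothGerm F 0
  F_zero : F 0 = 0
  grad_F_zero : fderiv ℝ F 0 = 0
  /-- The Taylor polynomial `j_N F` contains no pure terms. -/
  no_pure_terms : ∀ α : Fin n → ℕ, ∑ j, α j ≤ N → taylorCoeff F α 0 = 0 ∧ taylorCoeff F 0 α = 0
  rho_eq : ∀ j : Fin n, rho F j = rho r j.castSucc
  two_le_rho : ∀ j : Fin n, 2 ≤ rho F j
  smooth_R₁ : SmoothGerm R₁ 0
  smooth_R₂ : SmoothGerm R₂ 0
  R₂_bound : ∃ C : ℝ, 0 < C ∧ ∀ᶠ ζ : Fin (n + 1) → ℂ in 𝓝 0, |R₂ ζ| ≤ C * ‖ζ (Fin.last n)‖ ^ 2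

/-- `F` is plurisubharmonic near the origin: on an open neighbourhood `U` of `0` it is upper
semicontinuous and satisfies the sub-mean value inequality on every closed complex disc in `U`. -/
def IsPlurisubharmonicGerm {n : ℕ} (F : (Fin n → ℂ) → ℝ) : Prop :=
  ∃ U : Set (Fin n → ℂ), IsOpen U ∧ 0 ∈ U ∧ UpperSemicontinuousOn F U ∧
    ∀ z v : Fin n → ℂ, (∀ t : ℂ, ‖t‖ ≤ 1 → z + t • v ∈ U) →
      F z ≤ Real.circleAverage (fun t : ℂ => F (z + t • v)) 0 1

/-- `G` is invariant under the rotation: `G (e^{iθ} • z) = G z` for all `θ ∈ ℝ^n`. -/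
def IsRotationInvariant {n : ℕ} (G : (Fin n → ℂ) → ℂ) : Prop :=
  ∀ (θ : Fin n → ℝ) (z : Fin n → ℂ),
    G (fun j => Complex.exp (Complex.I * (θ j : ℂ)) * z j) = G z

end NewtonType

end

namespace NewtonType

/-! The given defining function `r` is itself nondegenerate. Fix a nonempty bounded face determined
by a positive integer vector `a`. There `r_κ` is the lowest weight part of the Taylor series of `r`,
where `z_j`, `z̄_j` have weight `a_j`. Call its weight `k`. Since `r` restricts to `F` on `w = 0`
and has a nonzero linear coefficient at `w`, `k` is at most the weight `L` of `w`. Two cases remain.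

If `k < L`, then `w` does not occur and `r_κ` is the lowest weight part `P` of `F`. Its exponents
lie on the Newton diagram of `F`, so rotation invariance leaves only terms `c_α |z^α|²`
(`eq_of_isRotationInvariant`). As the limit of `F(s^a z) / s^k` when `s → 0+`, `P` inherits the
sub-mean value inequality (`dilation_approx`, `weightedPart_subMean`). In logarithmic coordinates
`y_j = log |z_j|` it becomes `g(y) = ∑ c_α exp(2⟨α, y⟩)`, which is convex because the Levi form is
nonnegative (`levi_nonneg`), and which satisfies `g(y + s a) = exp(s k) g(y)`. Convexity along `a`
gives `g ≥ 0`. If `g(y₀) = 0`, then `y₀ + d/2` is the midpoint of `y₀ - s a` and `y₀ + d + s a`, so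
`g(y₀ + d/2) ≤ exp(s k) g(y₀ + d) / 2`, which tends to `0` as `s → -∞`. Thus one zero off the
coordinate hyperplanes forces `P = 0` (`sum_eq_zero_of_exists_zero`), against the independence of
the monomials `z^α z̄^β`. So `P` has no such zero (`weightedPart_ne_zero`).

If `k = L`, then `r_κ = P + 2 Re(C w)` with `C ≠ 0` and `P` depending only on the `|z_j|`. Replacing
`t` by `η t` with `η^L = -1` fixes the first summand on the curve and changes the sign of the
second, so the sum cannot vanish for all `t`. -/

/-! ### Linear differential operators on germs and their commutation. -/

/-- The operator `f ↦ (∂f/∂x_j + σ i ∂f/∂y_j) / 2`. -/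
noncomputable def wirtingerOp {m : ℕ} (σ : ℂ) (j : Fin m) (f : (Fin m → ℂ) → ℂ) :
    (Fin m → ℂ) → ℂ := fun z =>
  (1 / 2 : ℂ) * (fderiv ℝ f z (Pi.single j 1)
    + σ * (Complex.I * fderiv ℝ f z (Pi.single j Complex.I)))

theorem wirtinger_eq {m : ℕ} (j : Fin m) : wirtinger j = wirtingerOp (-1) j := by
  funext f z
  simp only [wirtinger, wirtingerOp]
  ring

theorem wirtingerBar_eq {m : ℕ} (j : Fin m) : wirtingerBar j = wirtingerOp 1 j := by
  funext f z
  simp only [wirtingerBar, wirtingerOp]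
  ring

/-- An operator on functions that acts linearly on germs at `0` of smooth functions. -/
structure GermLinear {m : ℕ} (T : ((Fin m → ℂ) → ℂ) → ((Fin m → ℂ) → ℂ)) : Prop where
  smooth : ∀ {f}, ContDiffAt ℝ ∞ f 0 → ContDiffAt ℝ ∞ (T f) 0
  congr : ∀ {f g}, f =ᶠ[𝓝 0] g → T f =ᶠ[𝓝 0] T g
  add : ∀ {f g}, ContDiffAt ℝ ∞ f 0 → ContDiffAt ℝ ∞ g 0 →
    T (fun z => f z + g z) =ᶠ[𝓝 0] fun z => T f z + T g z
  mul : ∀ (c : ℂ) {f}, ContDiffAt ℝ ∞ f 0 → T (fun z => c * f z) =ᶠ[𝓝 0] fun z => c * T f z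

/-- Two operators commute on germs at `0` of smooth functions. -/
def GermCommute {m : ℕ} (T S : ((Fin m → ℂ) → ℂ) → ((Fin m → ℂ) → ℂ)) : Prop :=
  ∀ f, ContDiffAt ℝ ∞ f 0 → T (S f) =ᶠ[𝓝 0] S (T f)

section Germ

variable {m : ℕ} {T S U : ((Fin m → ℂ) → ℂ) → ((Fin m → ℂ) → ℂ)}

theorem GermLinear.id : GermLinear (fun f : (Fin m → ℂ) → ℂ => f) :=
  ⟨fun h => h, fun h => h, fun _ _ => .rfl, fun _ _ _ => .rfl⟩

theorem GermLinear.comp (hT : GermLinear T) (hS : GermLinear S) :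
    GermLinear (fun f => T (S f)) where
  smooth h := hT.smooth (hS.smooth h)
  congr h := hT.congr (hS.congr h)
  add hf hg := (hT.congr (hS.add hf hg)).trans (hT.add (hS.smooth hf) (hS.smooth hg))
  mul c _ hf := (hT.congr (hS.mul c hf)).trans (hT.mul c (hS.smooth hf))

theorem GermLinear.iterate (hT : GermLinear T) (k : ℕ) : GermLinear (T^[k]) := by
  induction k with
  | zero => exact GermLinear.id
  | succ k ih => exact ih.comp hT

theorem GermLinear.foldr {D : Fin m → ((Fin m → ℂ) → ℂ) → ((Fin m → ℂ) → ℂ)}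
    (hD : ∀ j, GermLinear (D j)) (α : Fin m → ℕ) (l : List (Fin m)) :
    GermLinear (fun f => l.foldr (fun j g => (D j)^[α j] g) f) := by
  induction l with
  | nil => exact GermLinear.id
  | cons j l ih => exact ((hD j).iterate (α j)).comp ih

theorem GermCommute.comp (hS : GermLinear S) (hU : GermLinear U) (h1 : GermCommute T S)
    (h2 : GermCommute T U) : GermCommute T (fun f => S (U f)) := fun f hf =>
  (h1 _ (hU.smooth hf)).trans (hS.congr (h2 f hf))

theorem GermCommute.iterate (hS : GermLinear S) (h : GermCommute T S) (k : ℕ) :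
    GermCommute T (S^[k]) := by
  induction k with
  | zero => exact fun _ _ => .rfl
  | succ k ih => exact GermCommute.comp (S := S^[k]) (U := S) (hS.iterate k) hS ih h

theorem GermCommute.foldr {D : Fin m → ((Fin m → ℂ) → ℂ) → ((Fin m → ℂ) → ℂ)}
    (hD : ∀ j, GermLinear (D j)) (h : ∀ j, GermCommute T (D j)) (α : Fin m → ℕ)
    (l : List (Fin m)) :
    GermCommute T (fun f => l.foldr (fun j g => (D j)^[α j] g) f) := by
  induction l with
  | nil => exact fun _ _ => .rfl
  | cons j l ih =>
    exact GermCommute.comp ((hD j).iterate _) (GermLinear.foldr hD α l)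
      (GermCommute.iterate (hD j) (h j) _) ih

/-- The index `i` occurs exactly once in a list without repetitions, so one more power of `D i`
appears at one place, and commutation carries it to the front. -/
theorem foldr_add_single {D : Fin m → ((Fin m → ℂ) → ℂ) → ((Fin m → ℂ) → ℂ)}
    (hD : ∀ j, GermLinear (D j)) (hc : ∀ i j, GermCommute (D i) (D j)) (α : Fin m → ℕ)
    (i : Fin m) {l : List (Fin m)} (hl : l.Nodup) (hi : i ∈ l) {f : (Fin m → ℂ) → ℂ}
    (hf : ContDiffAt ℝ ∞ f 0) :
    l.foldr (fun j g => (D j)^[(α + (Pi.single i 1 : Fin m → ℕ)) j] g) f =ᶠ[𝓝 0]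
      D i (l.foldr (fun j g => (D j)^[α j] g) f) := by
  induction l with
  | nil => simp at hi
  | cons j l ih =>
    rw [List.nodup_cons] at hl
    simp only [List.foldr_cons]
    by_cases hij : j = i
    · subst hij
      have : l.foldr (fun k g => (D k)^[(α + (Pi.single j 1 : Fin m → ℕ)) k] g) f
          = l.foldr (fun k g => (D k)^[α k] g) f := by
        apply List.foldr_ext
        intro k hk g
        have : k ≠ j := fun h => hl.1 (h ▸ hk)
        simp [this]
      rw [this]
      simp only [Pi.add_apply, Pi.single_eq_same, Function.iterate_succ']
      exact .rfl
    · have hi' : i ∈ l := by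
        rcases List.mem_cons.1 hi with h | h
        · exact absurd h.symm hij
        · exact h
      have h1 := ((hD j).iterate (α j)).congr (ih hl.2 hi')
      simp only [Pi.add_apply, Pi.single_eq_of_ne hij, add_zero]
      refine h1.trans ?_
      exact (GermCommute.iterate (hD j) (hc i j) (α j) _
        ((GermLinear.foldr hD α l).smooth hf)).symm

end Germ

/-! ### Wirtinger operators and mixed jets at the origin. -/

section Operators

variable {m : ℕ}

theorem germLinear_wirtingerOp (σ : ℂ) (j : Fin m) : GermLinear (wirtingerOp σ j) where
  smooth := by
    intro f hf
    have h := hf.fderiv_right (m := ∞) (by simp)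
    unfold wirtingerOp
    fun_prop
  congr := by
    intro f g h
    filter_upwards [h.fderiv (𝕜 := ℝ)] with z hz
    simp only [wirtingerOp, hz]
  add := by
    intro f g hf hg
    filter_upwards [(hf.of_le (m := 1) (by simp)).eventually (by simp),
      (hg.of_le (m := 1) (by simp)).eventually (by simp)] with z h1 h2
    have := fderiv_fun_add (h1.differentiableAt (by simp)) (h2.differentiableAt (by simp))
    simp only [wirtingerOp, this, add_apply]
    ring
  mul := by
    intro c f hf
    filter_upwards [(hf.of_le (m := 1) (by simp)).eventually (by simp)] with z h1
    have := fderiv_const_mul (h1.differentiableAt (by simp)) c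
    simp only [wirtingerOp, this, smul_apply, smul_eq_mul]
    ring

theorem fderiv_wirtingerOp (σ : ℂ) (j : Fin m) {f : (Fin m → ℂ) → ℂ} {z : Fin m → ℂ}
    (hf : ContDiffAt ℝ 2 f z) (v : Fin m → ℂ) :
    fderiv ℝ (wirtingerOp σ j f) z v = (1 / 2 : ℂ) * (fderiv ℝ (fderiv ℝ f) z v (Pi.single j 1)
      + σ * (Complex.I * fderiv ℝ (fderiv ℝ f) z v (Pi.single j Complex.I))) := by
  have h : HasFDerivAt (fderiv ℝ f) (fderiv ℝ (fderiv ℝ f) z) z :=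
    ((hf.fderiv_right (m := 1) (by norm_num)).differentiableAt (by simp)).hasFDerivAt
  have h1 := h.clm_apply (hasFDerivAt_const (Pi.single j (1 : ℂ) : Fin m → ℂ) z)
  have h2 := h.clm_apply (hasFDerivAt_const (Pi.single j Complex.I : Fin m → ℂ) z)
  have := (h1.add ((h2.const_mul Complex.I).const_mul σ)).const_mul (1 / 2 : ℂ)
  have h3 : fderiv ℝ (wirtingerOp σ j f) z = _ := this.fderiv
  rw [h3]
  simp [mul_add]

/-- Symmetry of the second derivative. The parameters `σ`, `τ` treat the holomorphic,
antiholomorphic and mixed pairs at once. -/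
theorem germCommute_wirtingerOp (σ τ : ℂ) (i j : Fin m) :
    GermCommute (wirtingerOp σ i) (wirtingerOp τ j) := by
  intro f hf
  filter_upwards [(contDiffAt_infty.1 hf 2).eventually (by simp)] with z h
  have hs : ∀ u v, fderiv ℝ (fderiv ℝ f) z u v = fderiv ℝ (fderiv ℝ f) z v u :=
    fun u v => h.isSymmSndFDerivAt (by simp) u v
  conv_lhs => rw [wirtingerOp]
  conv_rhs => rw [wirtingerOp]
  simp only [fderiv_wirtingerOp _ _ h]
  rw [hs (Pi.single i 1), hs (Pi.single i 1), hs (Pi.single i Complex.I),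
    hs (Pi.single i Complex.I)]
  ring

theorem germLinear_wirtinger (j : Fin m) : GermLinear (wirtinger j) :=
  wirtinger_eq j ▸ germLinear_wirtingerOp _ j

theorem germLinear_wirtingerBar (j : Fin m) : GermLinear (wirtingerBar j) :=
  wirtingerBar_eq j ▸ germLinear_wirtingerOp _ j

theorem germLinear_iterWirtinger (α : Fin m → ℕ) : GermLinear (iterWirtinger α) :=
  GermLinear.foldr germLinear_wirtinger α _

theorem germLinear_iterWirtingerBar (β : Fin m → ℕ) : GermLinear (iterWirtingerBar β) :=
  GermLinear.foldr germLinear_wirtingerBar β _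

/-- The mixed derivative `D^α D̄^β f (0)`. -/
noncomputable def jet (α β : Fin m → ℕ) (f : (Fin m → ℂ) → ℂ) : ℂ :=
  iterWirtinger α (iterWirtingerBar β f) 0

theorem germLinear_jet (α β : Fin m → ℕ) :
    GermLinear (fun f => iterWirtinger α (iterWirtingerBar β f)) :=
  (germLinear_iterWirtinger α).comp (germLinear_iterWirtingerBar β)

theorem jet_congr (α β : Fin m → ℕ) {f g : (Fin m → ℂ) → ℂ} (h : f =ᶠ[𝓝 0] g) :
    jet α β f = jet α β g :=
  ((germLinear_jet α β).congr h).self_of_nhds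

theorem jet_add (α β : Fin m → ℕ) {f g : (Fin m → ℂ) → ℂ} (hf : ContDiffAt ℝ ∞ f 0)
    (hg : ContDiffAt ℝ ∞ g 0) : jet α β (fun z => f z + g z) = jet α β f + jet α β g :=
  ((germLinear_jet α β).add hf hg).self_of_nhds

theorem jet_mul (α β : Fin m → ℕ) (c : ℂ) {f : (Fin m → ℂ) → ℂ} (hf : ContDiffAt ℝ ∞ f 0) :
    jet α β (fun z => c * f z) = c * jet α β f :=
  ((germLinear_jet α β).mul c hf).self_of_nhds

theorem jet_sum {ι : Type*} (α β : Fin m → ℕ) (s : Finset ι) (f : ι → (Fin m → ℂ) → ℂ)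
    (hf : ∀ i, ContDiffAt ℝ ∞ (f i) 0) :
    jet α β (fun z => ∑ i ∈ s, f i z) = ∑ i ∈ s, jet α β (f i) := by
  classical
  induction s using Finset.induction_on with
  | empty =>
    have := jet_mul α β 0 (f := fun _ : Fin m → ℂ => (0 : ℂ)) contDiffAt_const
    simpa using this
  | insert i s hi ih =>
    simp only [Finset.sum_insert hi]
    rw [jet_add α β (hf i) (ContDiffAt.sum fun k _ => hf k), ih]

theorem iterWirtinger_zero (f : (Fin m → ℂ) → ℂ) : iterWirtinger 0 f = f := by
  unfold iterWirtinger
  induction List.finRange m with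
  | nil => rfl
  | cons j l ih => simp

theorem iterWirtingerBar_zero (f : (Fin m → ℂ) → ℂ) : iterWirtingerBar 0 f = f := by
  unfold iterWirtingerBar
  induction List.finRange m with
  | nil => rfl
  | cons j l ih => simp

theorem jet_zero (f : (Fin m → ℂ) → ℂ) : jet 0 0 f = f 0 := by
  rw [jet, iterWirtinger_zero, iterWirtingerBar_zero]

/-- The extra derivative is moved past both blocks of operators until it acts first. Jets of `f` of
higher order thus become jets of its derivatives, which drives the inductions on the order below. -/
theorem jet_add_single_left (α β : Fin m → ℕ) (j : Fin m) {f : (Fin m → ℂ) → ℂ}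
    (hf : ContDiffAt ℝ ∞ f 0) : jet (α + Pi.single j 1) β f = jet α β (wirtinger j f) := by
  have hg := (germLinear_iterWirtingerBar β).smooth hf
  have h0 : ∀ i k : Fin m, GermCommute (wirtinger i) (wirtinger k) := fun i k => by
    simpa only [wirtinger_eq] using germCommute_wirtingerOp _ _ i k
  have h0' : ∀ i k : Fin m, GermCommute (wirtinger i) (wirtingerBar k) := fun i k => by
    simpa only [wirtinger_eq, wirtingerBar_eq] using germCommute_wirtingerOp _ _ i k
  have h1 := foldr_add_single germLinear_wirtinger h0 α j (List.nodup_finRange m)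
    (List.mem_finRange j) hg
  have h2 := GermCommute.foldr germLinear_wirtinger (h0 j) α (List.finRange m) _ hg
  have h3 := GermCommute.foldr germLinear_wirtingerBar (h0' j) β (List.finRange m) _ hf
  have h4 := (germLinear_iterWirtinger α).congr h3
  exact (h1.trans (h2.trans h4)).self_of_nhds

theorem jet_add_single_right (α β : Fin m → ℕ) (j : Fin m) {f : (Fin m → ℂ) → ℂ}
    (hf : ContDiffAt ℝ ∞ f 0) : jet α (β + Pi.single j 1) f = jet α β (wirtingerBar j f) := by
  have h0 : ∀ i k : Fin m, GermCommute (wirtingerBar i) (wirtingerBar k) := fun i k => by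
    simpa only [wirtingerBar_eq] using germCommute_wirtingerOp _ _ i k
  have h1 := foldr_add_single germLinear_wirtingerBar h0 β j (List.nodup_finRange m)
    (List.mem_finRange j) hf
  have h3 := GermCommute.foldr germLinear_wirtingerBar (h0 j) β (List.finRange m) _ hf
  exact ((germLinear_iterWirtinger α).congr (h1.trans h3)).self_of_nhds

end Operators

/-! ### Jets and linear independence of the monomials `z^γ z̄^δ`. -/

section Monomials

variable {m : ℕ}

theorem multiIndex_induction {P : (Fin m → ℕ) → (Fin m → ℕ) → Prop} (zero : P 0 0)
    (left : ∀ α β j, P α β → P (α + Pi.single j 1) β)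
    (right : ∀ α β j, P α β → P α (β + Pi.single j 1)) (α β : Fin m → ℕ) : P α β := by
  have key : ∀ k : ℕ, ∀ α β : Fin m → ℕ, ∑ j, α j + ∑ j, β j = k → P α β := by
    intro k
    induction k with
    | zero =>
      intro α β h
      have hα : α = 0 := by
        ext j
        exact Finset.sum_eq_zero_iff.1 (show ∑ j, α j = 0 by omega) j (Finset.mem_univ j)
      have hβ : β = 0 := by
        ext j
        exact Finset.sum_eq_zero_iff.1 (show ∑ j, β j = 0 by omega) j (Finset.mem_univ j)
      rwa [hα, hβ]
    | succ k ih =>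
      have split : ∀ γ : Fin m → ℕ, ∑ j, γ j ≠ 0 →
          ∃ γ' j, γ = γ' + (Pi.single j 1 : Fin m → ℕ) ∧ ∑ j, γ j = ∑ j, γ' j + 1 := by
        intro γ h
        obtain ⟨j, -, hj⟩ := Finset.exists_ne_zero_of_sum_ne_zero h
        have : γ = (γ - (Pi.single j 1 : Fin m → ℕ)) + Pi.single j 1 := by
          refine (tsub_add_cancel_of_le fun i => ?_).symm
          by_cases hi : i = j
          · subst hi; simp; omega
          · simp [hi]
        refine ⟨_, j, this, ?_⟩
        conv_lhs => rw [this]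
        simp [Finset.sum_add_distrib]
      intro α β h
      by_cases hα : ∑ j, α j = 0
      · obtain ⟨γ, j, rfl, hγ⟩ := split β (by omega)
        exact right _ _ _ (ih _ _ (by omega))
      · obtain ⟨γ, j, rfl, hγ⟩ := split α hα
        exact left _ _ _ (ih _ _ (by omega))
  exact key _ α β rfl

/-- The monomial `z^γ z̄^δ`. -/
noncomputable def mixedMonomial (γ δ : Fin m → ℕ) (z : Fin m → ℂ) : ℂ :=
  (∏ j, z j ^ γ j) * ∏ j, (starRingEnd ℂ (z j)) ^ δ j

theorem contDiff_prod_pow (γ : Fin m → ℕ) :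
    ContDiff ℝ ∞ (fun z : Fin m → ℂ => ∏ j, z j ^ γ j) := by
  refine contDiff_prod fun j _ => ?_
  fun_prop

theorem prod_conj_pow (δ : Fin m → ℕ) (z : Fin m → ℂ) :
    ∏ j, (starRingEnd ℂ (z j)) ^ δ j = Complex.conjCLE (∏ j, z j ^ δ j) := by
  simp [map_prod, map_pow]

theorem contDiff_mixedMonomial (γ δ : Fin m → ℕ) : ContDiff ℝ ∞ (mixedMonomial γ δ) := by
  unfold mixedMonomial
  simp only [prod_conj_pow]
  exact (contDiff_prod_pow γ).mul
    (Complex.conjCLE.contDiff.comp (contDiff_prod_pow δ))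

/-- The truncated subtraction is harmless: when `γ j = 0` the factor `γ j` kills the term. -/
theorem fderiv_prod_pow (γ : Fin m → ℕ) (z : Fin m → ℂ) (j : Fin m) (v : ℂ) :
    fderiv ℝ (fun z : Fin m → ℂ => ∏ j, z j ^ γ j) z (Pi.single j v)
      = γ j * (∏ k, z k ^ (γ - (Pi.single j 1 : Fin m → ℕ)) k) * v := by
  have h : HasFDerivAt (fun z : Fin m → ℂ => ∏ j, z j ^ γ j) _ z :=
    HasFDerivAt.finsetProd (u := Finset.univ) fun j _ =>
      ((ContinuousLinearMap.proj (R := ℝ) (φ := fun _ : Fin m => ℂ) j).hasFDerivAt (x := z)).pow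
        (γ j)
  rw [h.fderiv]
  simp only [FunLike.coe_sum, Finset.sum_apply, smul_apply, smul_eq_mul,
    ContinuousLinearMap.proj_apply, nsmul_eq_mul]
  rw [Finset.sum_eq_single j]
  · rw [← Finset.mul_prod_erase Finset.univ (fun k => z k ^ (γ - (Pi.single j 1 : Fin m → ℕ)) k)
      (Finset.mem_univ j)]
    have : ∏ k ∈ Finset.univ.erase j, z k ^ (γ - (Pi.single j 1 : Fin m → ℕ)) k
        = ∏ k ∈ Finset.univ.erase j, z k ^ γ k := by
      refine Finset.prod_congr rfl fun k hk => ?_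
      simp [Finset.ne_of_mem_erase hk]
    rw [this]
    simp
    ring
  · intro k _ hk
    simp [hk]
  · simp

theorem fderiv_mixedMonomial (γ δ : Fin m → ℕ) (z : Fin m → ℂ) (j : Fin m) (v : ℂ) :
    fderiv ℝ (mixedMonomial γ δ) z (Pi.single j v)
      = γ j * mixedMonomial (γ - Pi.single j 1) δ z * v
        + δ j * mixedMonomial γ (δ - Pi.single j 1) z * starRingEnd ℂ v := by
  have h1 := ((contDiff_prod_pow γ).differentiable (by simp) z).hasFDerivAt
  have h2 := ((contDiff_prod_pow δ).differentiable (by simp) z).hasFDerivAt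
  have h3 := ((Complex.conjCLE : ℂ →L[ℝ] ℂ).hasFDerivAt (x := ∏ j, z j ^ δ j)).comp z h2
  have h4 := h1.mul h3
  have h5 : mixedMonomial γ δ = (fun z => ∏ j, z j ^ γ j) *
      (⇑(Complex.conjCLE : ℂ →L[ℝ] ℂ) ∘ fun z : Fin m → ℂ => ∏ j, z j ^ δ j) := by
    funext w
    simp only [mixedMonomial, prod_conj_pow]
    rfl
  rw [h5, h4.fderiv]
  simp only [mixedMonomial, prod_conj_pow, add_apply, smul_apply,
    ContinuousLinearMap.comp_apply, fderiv_prod_pow, smul_eq_mul, Function.comp]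
  simp
  ring

theorem wirtinger_mixedMonomial (γ δ : Fin m → ℕ) (j : Fin m) :
    wirtinger j (mixedMonomial γ δ)
      = fun z => (γ j : ℂ) * mixedMonomial (γ - Pi.single j 1) δ z := by
  funext z
  simp only [wirtinger, fderiv_mixedMonomial, map_one, Complex.conj_I]
  linear_combination (-(γ j : ℂ) * mixedMonomial (γ - Pi.single j 1) δ z
    + δ j * mixedMonomial γ (δ - Pi.single j 1) z) / 2 * Complex.I_mul_I

theorem wirtingerBar_mixedMonomial (γ δ : Fin m → ℕ) (j : Fin m) :
    wirtingerBar j (mixedMonomial γ δ)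
      = fun z => (δ j : ℂ) * mixedMonomial γ (δ - Pi.single j 1) z := by
  funext z
  simp only [wirtingerBar, fderiv_mixedMonomial, map_one, Complex.conj_I]
  linear_combination (γ j * mixedMonomial (γ - Pi.single j 1) δ z
    - δ j * mixedMonomial γ (δ - Pi.single j 1) z) / 2 * Complex.I_mul_I

theorem add_single_eq_iff (α γ : Fin m → ℕ) (j : Fin m) :
    α + Pi.single j 1 = γ ↔ γ j ≠ 0 ∧ α = γ - Pi.single j 1 := by
  constructor
  · rintro rfl
    simp
  · rintro ⟨h, rfl⟩
    refine tsub_add_cancel_of_le fun i => ?_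
    by_cases hi : i = j
    · subst hi; simp; omega
    · simp [hi]

theorem prod_factorial_add_single (α : Fin m → ℕ) (j : Fin m) :
    (∏ k, (((α + (Pi.single j 1 : Fin m → ℕ)) k).factorial : ℂ))
      = (α + (Pi.single j 1 : Fin m → ℕ)) j * ∏ k, ((α k).factorial : ℂ) := by
  rw [← Finset.mul_prod_erase Finset.univ _ (Finset.mem_univ j),
    ← Finset.mul_prod_erase Finset.univ (fun k => ((α k).factorial : ℂ)) (Finset.mem_univ j)]
  have : ∏ k ∈ Finset.univ.erase j, (((α + (Pi.single j 1 : Fin m → ℕ)) k).factorial : ℂ)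
      = ∏ k ∈ Finset.univ.erase j, ((α k).factorial : ℂ) := by
    refine Finset.prod_congr rfl fun k hk => ?_
    simp [Finset.ne_of_mem_erase hk]
  rw [this]
  simp [Nat.factorial_succ]
  ring

/-- Each derivative lowers one exponent and produces one factor of a factorial; evaluating the
result at the origin keeps only the constant monomial. -/
theorem jet_mixedMonomial (α β γ δ : Fin m → ℕ) :
    jet α β (mixedMonomial γ δ) = if α = γ ∧ β = δ then
      (∏ j, ((α j).factorial : ℂ)) * ∏ j, ((β j).factorial : ℂ) else 0 := by
  revert γ δ
  refine multiIndex_induction (P := fun α β => ∀ γ δ : Fin m → ℕ, jet α β (mixedMonomial γ δ)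
    = if α = γ ∧ β = δ then
      (∏ j, ((α j).factorial : ℂ)) * ∏ j, ((β j).factorial : ℂ) else 0) ?_ ?_ ?_ α β
  · intro γ δ
    have aux : ∀ η : Fin m → ℕ, ∏ j, (0 : ℂ) ^ η j = if 0 = η then 1 else 0 := by
      intro η
      split_ifs with h
      · simp [← h]
      · obtain ⟨j, hj⟩ := Function.ne_iff.1 h
        exact Finset.prod_eq_zero (Finset.mem_univ j) (zero_pow fun h => hj h.symm)
    rw [jet_zero, mixedMonomial]
    simp only [Pi.zero_apply, map_zero, aux]
    by_cases h1 : 0 = γ <;> by_cases h2 : 0 = δ <;> simp [h1, h2]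
  · intro α β j ih γ δ
    rw [jet_add_single_left _ _ _ (contDiff_mixedMonomial γ δ).contDiffAt,
      wirtinger_mixedMonomial, jet_mul _ _ _ (contDiff_mixedMonomial _ δ).contDiffAt, ih,
      prod_factorial_add_single]
    simp only [add_single_eq_iff]
    by_cases h : γ j = 0
    · simp [h]
    · by_cases h' : α = γ - Pi.single j 1 ∧ β = δ
      · rw [if_pos h', if_pos ⟨⟨h, h'.1⟩, h'.2⟩, (add_single_eq_iff α γ j).2 ⟨h, h'.1⟩]
        ring
      · rw [if_neg h', if_neg fun H => h' ⟨H.1.2, H.2⟩, mul_zero]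
  · intro α β j ih γ δ
    rw [jet_add_single_right _ _ _ (contDiff_mixedMonomial γ δ).contDiffAt,
      wirtingerBar_mixedMonomial, jet_mul _ _ _ (contDiff_mixedMonomial γ _).contDiffAt, ih,
      prod_factorial_add_single]
    simp only [add_single_eq_iff]
    by_cases h : δ j = 0
    · simp [h]
    · by_cases h' : α = γ ∧ β = δ - Pi.single j 1
      · rw [if_pos h', if_pos ⟨h'.1, h, h'.2⟩, (add_single_eq_iff β δ j).2 ⟨h, h'.2⟩]
        ring
      · rw [if_neg h', if_neg fun H => h' ⟨H.1, H.2.2⟩, mul_zero]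

theorem factorials_ne_zero (α β : Fin m → ℕ) :
    (∏ j, ((α j).factorial : ℂ)) * ∏ j, ((β j).factorial : ℂ) ≠ 0 :=
  mul_ne_zero (Finset.prod_ne_zero_iff.2 fun _ _ => by exact_mod_cast Nat.factorial_ne_zero _)
    (Finset.prod_ne_zero_iff.2 fun _ _ => by exact_mod_cast Nat.factorial_ne_zero _)

set_option maxHeartbeats 400000 in
theorem jet_sum_mixedMonomial (Q : Finset ((Fin m → ℕ) × (Fin m → ℕ)))
    (c : (Fin m → ℕ) × (Fin m → ℕ) → ℂ) (α β : Fin m → ℕ) :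
    jet α β (fun z => ∑ q ∈ Q, c q * mixedMonomial q.1 q.2 z)
      = if (α, β) ∈ Q then
          c (α, β) * ((∏ j, ((α j).factorial : ℂ)) * ∏ j, ((β j).factorial : ℂ)) else 0 := by
  have h0 := jet_sum α β Q (fun q z => c q * mixedMonomial q.1 q.2 z)
    fun q => (contDiff_const.mul (contDiff_mixedMonomial q.1 q.2)).contDiffAt
  rw [h0]
  have : ∀ q ∈ Q, jet α β (fun z => c q * mixedMonomial q.1 q.2 z) = if (α, β) = q then
      c q * ((∏ j, ((α j).factorial : ℂ)) * ∏ j, ((β j).factorial : ℂ)) else 0 := by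
    rintro ⟨γ, δ⟩ -
    rw [jet_mul _ _ _ (contDiff_mixedMonomial γ δ).contDiffAt, jet_mixedMonomial, mul_ite,
      mul_zero]
    simp only [Prod.mk.injEq]
  rw [Finset.sum_congr rfl this, Finset.sum_ite_eq]

/-- The monomials `z^γ z̄^δ` are linearly independent. -/
theorem coeff_eq_zero_of_sum_mixedMonomial_eq_zero (Q : Finset ((Fin m → ℕ) × (Fin m → ℕ)))
    (c : (Fin m → ℕ) × (Fin m → ℕ) → ℂ)
    (h : ∀ z, ∑ q ∈ Q, c q * mixedMonomial q.1 q.2 z = 0) : ∀ q ∈ Q, c q = 0 := by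
  rintro ⟨α, β⟩ hq
  have h1 := jet_sum_mixedMonomial Q c α β
  rw [if_pos hq, funext h] at h1
  have h2 := jet_mul α β 0 (f := fun _ : Fin m → ℂ => (0 : ℂ)) contDiffAt_const
  simp only [mul_zero, zero_mul] at h2
  rw [h2] at h1
  exact (mul_eq_zero.1 h1.symm).resolve_right (factorials_ne_zero α β)

end Monomials

/-! ### Taylor's formula in the variables `z`, `z̄`. -/

section Taylor

variable {m : ℕ}

/-- The differential sends `v` to `∑ (v_j ∂_j f + v̄_j ∂̄_j f)`, so estimates on Wirtinger
derivatives feed the mean value inequality. -/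
theorem norm_fderiv_le (f : (Fin m → ℂ) → ℂ) (z : Fin m → ℂ) :
    ‖fderiv ℝ f z‖ ≤ ∑ j, (‖wirtinger j f z‖ + ‖wirtingerBar j f z‖) := by
  refine ContinuousLinearMap.opNorm_le_bound _ (Finset.sum_nonneg fun _ _ => by positivity) ?_
  intro v
  have h1 : ∀ j, fderiv ℝ f z (Pi.single j (v j))
      = v j * wirtinger j f z + starRingEnd ℂ (v j) * wirtingerBar j f z := by
    intro j
    have : (Pi.single j (v j) : Fin m → ℂ)
        = (v j).re • (Pi.single j 1 : Fin m → ℂ)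
          + (v j).im • (Pi.single j Complex.I : Fin m → ℂ) := by
      rw [← Pi.single_smul', ← Pi.single_smul', ← Pi.single_add]
      congr 1
      simp [Complex.re_add_im]
    have h2 : starRingEnd ℂ (v j) = (v j).re - (v j).im * Complex.I := by
      apply Complex.ext <;> simp
    rw [this, map_add, map_smul, map_smul, h2]
    simp only [wirtinger, wirtingerBar, Complex.real_smul]
    linear_combination (1 / 2 * (fderiv ℝ f z (Pi.single j 1)
      - Complex.I * fderiv ℝ f z (Pi.single j Complex.I))) * Complex.re_add_im (v j)
      + (v j).im * fderiv ℝ f z (Pi.single j Complex.I) * Complex.I_mul_I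
  have h3 : fderiv ℝ f z v
      = ∑ j, (v j * wirtinger j f z + starRingEnd ℂ (v j) * wirtingerBar j f z) := by
    conv_lhs => rw [← Finset.univ_sum_single v, map_sum]
    exact Finset.sum_congr rfl fun j _ => h1 j
  rw [h3, Finset.sum_mul]
  refine (norm_sum_le _ _).trans (Finset.sum_le_sum fun j _ => ?_)
  refine (norm_add_le _ _).trans ?_
  rw [norm_mul, norm_mul, RCLike.norm_conj, ← mul_add, mul_comm]
  gcongr
  exact norm_le_pi_norm v j

/-- A smooth germ whose mixed Wirtinger derivatives of order `< K` vanish is `O(‖z‖^K)`. -/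
theorem isBigO_of_jet_eq_zero (K : ℕ) {f : (Fin m → ℂ) → ℂ} (hf : ContDiffAt ℝ ∞ f 0)
    (h : ∀ α β : Fin m → ℕ, ∑ j, α j + ∑ j, β j < K → jet α β f = 0) :
    ∃ C : ℝ, ∀ᶠ z in 𝓝 (0 : Fin m → ℂ), ‖f z‖ ≤ C * ‖z‖ ^ K := by
  induction K generalizing f with
  | zero =>
    refine ⟨‖f 0‖ + 1, ?_⟩
    have := hf.continuousAt.norm.eventually (gt_mem_nhds (lt_add_one ‖f 0‖))
    filter_upwards [this] with z hz
    simpa using hz.le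
  | succ K ih =>
    have hW : ∀ j, ∃ C : ℝ, ∀ᶠ z in 𝓝 (0 : Fin m → ℂ), ‖wirtinger j f z‖ ≤ C * ‖z‖ ^ K := by
      intro j
      refine ih ((germLinear_wirtinger j).smooth hf) fun α β hαβ => ?_
      rw [← jet_add_single_left _ _ _ hf]
      refine h _ _ ?_
      simp [Finset.sum_add_distrib]
      omega
    have hB : ∀ j, ∃ C : ℝ, ∀ᶠ z in 𝓝 (0 : Fin m → ℂ), ‖wirtingerBar j f z‖ ≤ C * ‖z‖ ^ K := by
      intro j
      refine ih ((germLinear_wirtingerBar j).smooth hf) fun α β hαβ => ?_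
      rw [← jet_add_single_right _ _ _ hf]
      refine h _ _ ?_
      simp [Finset.sum_add_distrib]
      omega
    choose C hC using hW
    choose D hD using hB
    have hfd : ∀ᶠ z in 𝓝 (0 : Fin m → ℂ),
        ‖fderiv ℝ f z‖ ≤ (∑ j, (|C j| + |D j|)) * ‖z‖ ^ K := by
      filter_upwards [eventually_all.2 hC, eventually_all.2 hD] with z h1 h2
      refine (norm_fderiv_le f z).trans ?_
      rw [Finset.sum_mul]
      refine Finset.sum_le_sum fun j _ => ?_
      rw [add_mul]
      refine add_le_add ((h1 j).trans ?_) ((h2 j).trans ?_) <;> gcongr <;> exact le_abs_self _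
    have hdiff : ∀ᶠ z in 𝓝 (0 : Fin m → ℂ), DifferentiableAt ℝ f z := by
      filter_upwards [(contDiffAt_infty.1 hf 1).eventually (by simp)] with z hz
      exact hz.differentiableAt (by simp)
    obtain ⟨ε, hε, hball⟩ := Metric.eventually_nhds_iff_ball.1 (hfd.and hdiff)
    refine ⟨∑ j, (|C j| + |D j|), ?_⟩
    filter_upwards [Metric.ball_mem_nhds 0 hε] with z hz
    have hz' : ‖z‖ < ε := by simpa using hz
    have hsub : ∀ x ∈ Metric.closedBall (0 : Fin m → ℂ) ‖z‖, x ∈ Metric.ball 0 ε := by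
      intro x hx
      simp only [mem_closedBall_zero_iff, mem_ball_zero_iff] at hx ⊢
      exact hx.trans_lt hz'
    -- On the ball of radius `‖z‖` the differential is at most a constant times `‖z‖ ^ K`;
    -- integrating along the segment from `0` to `z` gains the missing power.
    have hmv := (convex_closedBall (0 : Fin m → ℂ) ‖z‖).norm_image_sub_le_of_norm_fderiv_le
      (𝕜 := ℝ) (f := f) (C := (∑ j, (|C j| + |D j|)) * ‖z‖ ^ K) (x := 0) (y := z)
      (fun x hx => (hball x (hsub x hx)).2) ?_ (by simp) (by simp)
    · have h0 : f 0 = 0 := by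
        rw [← jet_zero f]
        exact h 0 0 (by simp)
      rw [h0, sub_zero, sub_zero] at hmv
      rwa [pow_succ, ← mul_assoc]
    · intro x hx
      refine (hball x (hsub x hx)).1.trans ?_
      have : ‖x‖ ≤ ‖z‖ := by simpa using hx
      gcongr

theorem SmoothGerm.contDiffAt_ofReal {F : (Fin m → ℂ) → ℝ} (hF : SmoothGerm F 0) :
    ContDiffAt ℝ ∞ (fun z => (F z : ℂ)) 0 := by
  obtain ⟨U, hU, h0, h⟩ := hF
  exact (Complex.ofRealCLM.contDiff.contDiffAt).comp (0 : Fin m → ℂ)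
    (h.contDiffAt (hU.mem_nhds h0))

theorem taylorCoeff_eq (F : (Fin m → ℂ) → ℝ) (α β : Fin m → ℕ) :
    taylorCoeff F α β = ((∏ j, ((α j).factorial : ℂ)) * ∏ j, ((β j).factorial : ℂ))⁻¹ *
      jet α β (fun z => (F z : ℂ)) := rfl

/-- Taylor's formula in the coordinates `z`, `z̄`. -/
theorem taylor_formula {F : (Fin m → ℂ) → ℝ} (hF : SmoothGerm F 0) (K : ℕ)
    (Q : Finset ((Fin m → ℕ) × (Fin m → ℕ)))
    (hQ : ∀ α β : Fin m → ℕ, ∑ j, α j + ∑ j, β j < K → (α, β) ∈ Q) :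
    ∃ C : ℝ, ∀ᶠ z in 𝓝 (0 : Fin m → ℂ),
      ‖(F z : ℂ) - ∑ q ∈ Q, taylorCoeff F q.1 q.2 * mixedMonomial q.1 q.2 z‖ ≤ C * ‖z‖ ^ K := by
  have hP : ContDiff ℝ ∞ (fun z : Fin m → ℂ =>
      ∑ q ∈ Q, taylorCoeff F q.1 q.2 * mixedMonomial q.1 q.2 z) :=
    ContDiff.sum fun q _ => contDiff_const.mul (contDiff_mixedMonomial q.1 q.2)
  have hneg : ContDiff ℝ ∞ (fun z : Fin m → ℂ => (-1 : ℂ) *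
      ∑ q ∈ Q, taylorCoeff F q.1 q.2 * mixedMonomial q.1 q.2 z) := contDiff_const.mul hP
  -- Subtracting the polynomial kills every jet of order below `K`, because `hQ` puts all such
  -- indices in `Q`; further monomials in `Q` do not affect these jets.
  have key := isBigO_of_jet_eq_zero K (hF.contDiffAt_ofReal.add hneg.contDiffAt) ?_
  · simpa only [Pi.add_apply, neg_one_mul, ← sub_eq_add_neg] using key
  · intro α β hαβ
    refine (jet_add α β hF.contDiffAt_ofReal hneg.contDiffAt).trans ?_
    rw [jet_mul α β (-1) hP.contDiffAt,
      jet_sum_mixedMonomial Q (fun q => taylorCoeff F q.1 q.2), if_pos (hQ α β hαβ),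
      taylorCoeff_eq]
    linear_combination (-jet α β (fun z => (F z : ℂ)))
      * inv_mul_cancel₀ (factorials_ne_zero α β)

end Taylor

/-! ### Circle averages of polynomials. -/

section Parseval

/-- On the unit circle the conjugate of `t` is its inverse, so the integrand is the power `t^(k -
i)`, whose mean vanishes unless the exponent is zero. -/
theorem circleAverage_pow_mul_conj_pow (k i : ℕ) :
    Real.circleAverage (fun t : ℂ => t ^ k * starRingEnd ℂ t ^ i) 0 1
      = if k = i then 1 else 0 := by
  have h1 : Real.circleAverage (fun t : ℂ => t ^ k * starRingEnd ℂ t ^ i) 0 1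
      = Real.circleAverage (fun t : ℂ => (t - 0) ^ ((k : ℤ) - i)) 0 1 := by
    refine Real.circleAverage_congr_sphere fun t ht => ?_
    have ht' : ‖t‖ = 1 := by simpa using ht
    have h0 : t ≠ 0 := by
      rintro rfl
      simp at ht'
    simp only [sub_zero]
    rw [zpow_sub₀ h0, ← Complex.inv_eq_conj ht', inv_pow, zpow_natCast, zpow_natCast,
      div_eq_mul_inv]
  rw [h1]
  split_ifs with h
  · subst h
    simp [Real.circleAverage_const]
  · rw [Real.circleAverage_eq_circleIntegral one_ne_zero]
    have h2 : (∮ t in C(0, 1), (t - 0)⁻¹ • (t - 0) ^ ((k : ℤ) - i))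
        = ∮ t in C(0, 1), (t - 0) ^ ((k : ℤ) - i - 1) := by
      refine circleIntegral.integral_congr zero_le_one fun t ht => ?_
      have h0 : t - 0 ≠ 0 := by
        rw [sub_zero]
        rintro rfl
        simp at ht
      simp only [smul_eq_mul]
      rw [zpow_sub_one₀ h0, mul_comm]
    rw [h2, circleIntegral.integral_sub_zpow_of_ne (by omega), smul_zero]

/-- The polynomial with coefficients `‖p_k‖²`. -/
noncomputable def normSqCoeff (p : Polynomial ℂ) : Polynomial ℝ :=
  ∑ k ∈ Finset.range (p.natDegree + 1), Polynomial.monomial k (‖p.coeff k‖ ^ 2)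

theorem coeff_normSqCoeff (p : Polynomial ℂ) (k : ℕ) :
    (normSqCoeff p).coeff k = ‖p.coeff k‖ ^ 2 := by
  rw [normSqCoeff, Polynomial.finsetSum_coeff]
  simp only [Polynomial.coeff_monomial]
  rw [Finset.sum_ite_eq']
  split_ifs with h
  · rfl
  · rw [Polynomial.coeff_eq_zero_of_natDegree_lt (by simpa using h)]
    simp

/-- Parseval's formula for polynomials. -/
theorem circleAverage_norm_eval_sq (p : Polynomial ℂ) (ε : ℝ) :
    Real.circleAverage (fun t : ℂ => ‖p.eval (ε * t)‖ ^ 2) 0 1 = (normSqCoeff p).eval (ε ^ 2) := by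
  have hc : ∀ t : ℂ, ((‖p.eval (ε * t)‖ ^ 2 : ℝ) : ℂ)
      = ∑ k ∈ Finset.range (p.natDegree + 1), ∑ i ∈ Finset.range (p.natDegree + 1),
        (p.coeff k * starRingEnd ℂ (p.coeff i) * ε ^ (k + i)) • (t ^ k * starRingEnd ℂ t ^ i) := by
    intro t
    push_cast
    rw [← Complex.mul_conj', Polynomial.eval_eq_sum_range, map_sum, Finset.sum_mul_sum]
    refine Finset.sum_congr rfl fun k _ => Finset.sum_congr rfl fun i _ => ?_
    simp only [map_mul, map_pow, Complex.conj_ofReal, smul_eq_mul]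
    ring
  have hcont : ∀ k i : ℕ, Continuous fun t : ℂ =>
      (p.coeff k * starRingEnd ℂ (p.coeff i) * ε ^ (k + i)) • (t ^ k * starRingEnd ℂ t ^ i) := by
    intro k i
    fun_prop
  have h1 : Real.circleAverage (fun t : ℂ => ((‖p.eval (ε * t)‖ ^ 2 : ℝ) : ℂ)) 0 1
      = ((Real.circleAverage (fun t : ℂ => ‖p.eval (ε * t)‖ ^ 2) 0 1 : ℝ) : ℂ) := by
    have hi : CircleIntegrable (fun t : ℂ => ‖p.eval (ε * t)‖ ^ 2) 0 1 := by
      refine ContinuousOn.circleIntegrable' (Continuous.continuousOn ?_)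
      have := p.continuous
      fun_prop
    exact Complex.ofRealCLM.circleAverage_comp_comm hi
  apply Complex.ofReal_injective
  rw [← h1]
  simp only [hc]
  rw [Real.circleAverage_fun_sum fun k _ => ?_]
  · have h2 : ∀ k ∈ Finset.range (p.natDegree + 1),
        Real.circleAverage (fun t : ℂ => ∑ i ∈ Finset.range (p.natDegree + 1),
          (p.coeff k * starRingEnd ℂ (p.coeff i) * ε ^ (k + i)) •
            (t ^ k * starRingEnd ℂ t ^ i)) 0 1
        = ((‖p.coeff k‖ ^ 2 * (ε ^ 2) ^ k : ℝ) : ℂ) := by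
      intro k hk
      rw [Real.circleAverage_fun_sum fun i _ => (hcont k i).continuousOn.circleIntegrable']
      simp only [Real.circleAverage_fun_smul]
      simp only [circleAverage_pow_mul_conj_pow, smul_eq_mul, mul_ite, mul_one, mul_zero]
      rw [Finset.sum_ite_eq, if_pos hk, Complex.mul_conj']
      push_cast
      ring
    rw [Finset.sum_congr rfl h2, normSqCoeff, Polynomial.eval_finsetSum]
    push_cast
    refine Finset.sum_congr rfl fun k _ => ?_
    simp
  · exact (continuous_finsetSum _ fun i _ => hcont k i).continuousOn.circleIntegrable'

/-- The quotient `(H(y) - H(0)) / y` is the polynomial `H.divX`, and the coefficient is its limit as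
`y → 0+`. -/
theorem coeff_one_nonneg {H : Polynomial ℝ} (h : ∀ y : ℝ, 0 < y → H.coeff 0 ≤ H.eval y) :
    0 ≤ H.coeff 1 := by
  have h1 : ∀ᶠ y in 𝓝[>] (0 : ℝ), 0 ≤ H.divX.eval y := by
    filter_upwards [self_mem_nhdsWithin] with y (hy : 0 < y)
    have h2 := h y hy
    conv_rhs at h2 => rw [← Polynomial.divX_mul_X_add H]
    simp only [Polynomial.eval_add, Polynomial.eval_mul, Polynomial.eval_X,
      Polynomial.eval_C] at h2
    exact nonneg_of_mul_nonneg_left (by linarith) hy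
  have h3 : Tendsto (fun y : ℝ => H.divX.eval y) (𝓝[>] 0) (𝓝 (H.divX.eval 0)) :=
    (H.divX.continuous.tendsto 0).mono_left nhdsWithin_le_nhds
  have h4 := ge_of_tendsto h3 h1
  rwa [← Polynomial.coeff_zero_eq_eval_zero, Polynomial.coeff_divX, zero_add] at h4

end Parseval

/-! ### Convexity in logarithmic coordinates and the propagation of zeros. -/

section Convexity

variable {n : ℕ}

/-- The polynomial `∏_j (1 + x_j τ)^{α_j}` in `τ`. -/
noncomputable def rayPolynomial (x : Fin n → ℝ) (α : Fin n → ℕ) : Polynomial ℂ :=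
  ∏ j, (1 + Polynomial.C (x j : ℂ) * Polynomial.X) ^ α j

/-- To first order in `τ` the product is `1 + ⟨α, x⟩ τ`; the second coefficient will produce the
Levi form. -/
theorem coeff_rayPolynomial (x : Fin n → ℝ) (α : Fin n → ℕ) :
    (rayPolynomial x α).coeff 0 = 1 ∧
      (rayPolynomial x α).coeff 1 = ((∑ j, (α j : ℝ) * x j : ℝ) : ℂ) := by
  have hpow : ∀ (y : ℂ) (k : ℕ), ((1 + Polynomial.C y * Polynomial.X) ^ k).coeff 0 = 1 ∧
      ((1 + Polynomial.C y * Polynomial.X) ^ k).coeff 1 = k * y := by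
    intro y k
    induction k with
    | zero => simp [Polynomial.coeff_one]
    | succ k ih =>
      rw [pow_succ, Polynomial.mul_coeff_zero, Polynomial.mul_coeff_one, ih.1, ih.2]
      simp [Polynomial.coeff_one]
      ring
  have hprod : ∀ s : Finset (Fin n),
      (∏ j ∈ s, (1 + Polynomial.C (x j : ℂ) * Polynomial.X) ^ α j).coeff 0 = 1 ∧
      (∏ j ∈ s, (1 + Polynomial.C (x j : ℂ) * Polynomial.X) ^ α j).coeff 1
        = ((∑ j ∈ s, (α j : ℝ) * x j : ℝ) : ℂ) := by
    intro s
    induction s using Finset.induction_on with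
    | empty => simp [Polynomial.coeff_one]
    | insert i s hi ih =>
      rw [Finset.prod_insert hi, Polynomial.mul_coeff_zero, Polynomial.mul_coeff_one, ih.1, ih.2,
        (hpow _ _).1, (hpow _ _).2, Finset.sum_insert hi]
      push_cast
      exact ⟨by ring, by ring⟩
  exact hprod Finset.univ

/-- The Levi form of a plurisubharmonic polynomial `∑ c_α |z^α|²` is nonnegative. -/
theorem levi_nonneg (A : Finset (Fin n → ℕ)) (c : (Fin n → ℕ) → ℝ)
    (hsub : ∀ z v : Fin n → ℂ, ∑ α ∈ A, c α * ∏ j, ‖z j‖ ^ (2 * α j) ≤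
      Real.circleAverage (fun t : ℂ => ∑ α ∈ A, c α * ∏ j, ‖(z + t • v) j‖ ^ (2 * α j)) 0 1)
    (z : Fin n → ℂ) (x : Fin n → ℝ) :
    0 ≤ ∑ α ∈ A, c α * (∏ j, ‖z j‖ ^ (2 * α j)) * (∑ j, (α j : ℝ) * x j) ^ 2 := by
  set H : Polynomial ℝ := ∑ α ∈ A, Polynomial.C (c α * ∏ j, ‖z j‖ ^ (2 * α j)) *
    normSqCoeff (rayPolynomial x α) with hH
  have hcoeff : ∀ k, H.coeff k = ∑ α ∈ A, c α * (∏ j, ‖z j‖ ^ (2 * α j)) *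
      ‖(rayPolynomial x α).coeff k‖ ^ 2 := by
    intro k
    rw [hH, Polynomial.finsetSum_coeff]
    simp only [Polynomial.coeff_C_mul, coeff_normSqCoeff]
  have h1 : H.coeff 1
      = ∑ α ∈ A, c α * (∏ j, ‖z j‖ ^ (2 * α j)) * (∑ j, (α j : ℝ) * x j) ^ 2 := by
    rw [hcoeff]
    refine Finset.sum_congr rfl fun α _ => ?_
    rw [(coeff_rayPolynomial x α).2, Complex.norm_real, Real.norm_eq_abs, sq_abs]
  rw [← h1]
  refine coeff_one_nonneg fun y hy => ?_
  -- With `v_j = √y x_j z_j` each monomial factors as `(z + t v)^α = z^α ∏ (1 + x_j √y t)^(α_j)`. By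
  -- Parseval the circle average is then a polynomial in `y`, with the value at `z` as its constant
  -- term.
  have hsub' := hsub z (fun j => (Real.sqrt y : ℂ) * x j * z j)
  have h2 : ∀ t : ℂ, ∑ α ∈ A, c α *
      ∏ j, ‖(z + t • fun j => (Real.sqrt y : ℂ) * x j * z j) j‖ ^ (2 * α j)
      = ∑ α ∈ A, (c α * ∏ j, ‖z j‖ ^ (2 * α j)) •
        ‖(rayPolynomial x α).eval (Real.sqrt y * t)‖ ^ 2 := by
    intro t
    refine Finset.sum_congr rfl fun α _ => ?_
    rw [smul_eq_mul, mul_assoc, rayPolynomial, Polynomial.eval_prod, norm_prod,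
      ← Finset.prod_pow, ← Finset.prod_mul_distrib]
    congr 1
    refine Finset.prod_congr rfl fun j _ => ?_
    have : (z + t • fun j => (Real.sqrt y : ℂ) * x j * z j) j
        = z j * (1 + x j * (Real.sqrt y * t)) := by
      simp
      ring
    rw [this]
    simp only [Polynomial.eval_pow, Polynomial.eval_add, Polynomial.eval_one,
      Polynomial.eval_mul, Polynomial.eval_C, Polynomial.eval_X, norm_mul, norm_pow]
    rw [mul_pow, ← pow_mul, mul_comm (α j) 2]
  simp only [h2] at hsub'
  rw [Real.circleAverage_fun_sum fun α _ => ?_] at hsub'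
  · simp only [Real.circleAverage_fun_smul, circleAverage_norm_eval_sq, Real.sq_sqrt hy.le]
      at hsub'
    have h3 : H.coeff 0 = ∑ α ∈ A, c α * ∏ j, ‖z j‖ ^ (2 * α j) := by
      rw [hcoeff]
      refine Finset.sum_congr rfl fun α _ => ?_
      rw [(coeff_rayPolynomial x α).1]
      simp
    rw [h3, hH, Polynomial.eval_finsetSum]
    simpa only [Polynomial.eval_mul, Polynomial.eval_C, smul_eq_mul] using hsub'
  · refine ContinuousOn.circleIntegrable' (Continuous.continuousOn ?_)
    have := (rayPolynomial x α).continuous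
    fun_prop

/-- A plurisubharmonic weighted homogeneous polynomial `∑ c_α |z^α|²` of positive weight with a
zero off the coordinate hyperplanes vanishes identically on the positive orthant. -/
theorem sum_eq_zero_of_exists_zero (A : Finset (Fin n → ℕ)) (c : (Fin n → ℕ) → ℝ)
    (a : Fin n → ℕ) {l : ℕ} (hl : l ≠ 0) (hA : ∀ α ∈ A, ∑ j, a j * (2 * α j) = l)
    (hsub : ∀ z v : Fin n → ℂ, ∑ α ∈ A, c α * ∏ j, ‖z j‖ ^ (2 * α j) ≤
      Real.circleAverage (fun t : ℂ => ∑ α ∈ A, c α * ∏ j, ‖(z + t • v) j‖ ^ (2 * α j)) 0 1)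
    {z₀ : Fin n → ℂ} (hz₀ : ∀ j, z₀ j ≠ 0) (h0 : ∑ α ∈ A, c α * ∏ j, ‖z₀ j‖ ^ (2 * α j) = 0)
    {x : Fin n → ℝ} (hx : ∀ j, 0 < x j) : ∑ α ∈ A, c α * ∏ j, x j ^ (2 * α j) = 0 := by
  set P : (Fin n → ℕ) → (Fin n → ℝ) → ℝ := fun α y => ∑ j, (α j : ℝ) * y j with hP
  have hPadd : ∀ α y y', P α (y + y') = P α y + P α y' := by
    intro α y y'
    simp [hP, mul_add, Finset.sum_add_distrib]
  have hPsmul : ∀ α (s : ℝ) y, P α (s • y) = s * P α y := by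
    intro α s y
    simp only [hP, Pi.smul_apply, smul_eq_mul, Finset.mul_sum]
    exact Finset.sum_congr rfl fun j _ => by ring
  have hPa : ∀ α ∈ A, 2 * P α (fun j => (a j : ℝ)) = l := by
    intro α hα
    rw [← hA α hα]
    simp only [hP, Finset.mul_sum]
    push_cast
    exact Finset.sum_congr rfl fun j _ => by ring
  set g : (Fin n → ℝ) → ℝ := fun y => ∑ α ∈ A, c α * Real.exp (2 * P α y) with hg
  have hexp : ∀ (α : Fin n → ℕ) (y : Fin n → ℝ),
      ∏ j, Real.exp (y j) ^ (2 * α j) = Real.exp (2 * P α y) := by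
    intro α y
    simp only [hP, Finset.mul_sum, Real.exp_sum]
    refine Finset.prod_congr rfl fun j _ => ?_
    rw [← Real.exp_nat_mul]
    push_cast
    ring_nf
  have hlog : ∀ x : Fin n → ℝ, (∀ j, 0 < x j) →
      ∑ α ∈ A, c α * ∏ j, x j ^ (2 * α j) = g (fun j => Real.log (x j)) := by
    intro x hx
    refine Finset.sum_congr rfl fun α _ => ?_
    rw [← hexp]
    simp only [Real.exp_log (hx _)]
  have hlevi : ∀ y d : Fin n → ℝ, 0 ≤ ∑ α ∈ A, c α * Real.exp (2 * P α y) * P α d ^ 2 := by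
    intro y d
    have := levi_nonneg A c hsub (fun j => (Real.exp (y j) : ℂ)) d
    simpa only [Complex.norm_real, Real.norm_eq_abs, Real.abs_exp, hexp] using this
  -- In the direction `a` every `⟨α, a⟩` equals `l / 2`, so the Levi form there is `(l / 2)²` times
  -- `g`.
  have hnonneg : ∀ y, 0 ≤ g y := by
    intro y
    have h1 := hlevi y (fun j => (a j : ℝ))
    have h2 : ∑ α ∈ A, c α * Real.exp (2 * P α y) * P α (fun j => (a j : ℝ)) ^ 2
        = g y * ((l : ℝ) / 2) ^ 2 := by
      rw [hg, Finset.sum_mul]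
      refine Finset.sum_congr rfl fun α hα => ?_
      rw [← hPa α hα]
      ring
    rw [h2] at h1
    have : (0 : ℝ) < ((l : ℝ) / 2) ^ 2 := by positivity
    exact nonneg_of_mul_nonneg_left h1 this
  -- The second derivative of `g` along the line `y + τ d` is four times the Levi form, so `g` is
  -- convex along it; midpoint convexity is all that is needed.
  have hmid : ∀ y d : Fin n → ℝ, g (y + (1 / 2 : ℝ) • d) ≤ (g y + g (y + d)) / 2 := by
    intro y d
    set φ : ℝ → ℝ := fun τ => ∑ α ∈ A, c α * Real.exp (2 * P α y + τ * (2 * P α d)) with hφ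
    have hgφ : ∀ τ : ℝ, g (y + τ • d) = φ τ := by
      intro τ
      refine Finset.sum_congr rfl fun α _ => ?_
      rw [hPadd, hPsmul]
      ring_nf
    have hderiv : ∀ b : (Fin n → ℕ) → ℝ, deriv (fun τ : ℝ =>
        ∑ α ∈ A, b α * Real.exp (2 * P α y + τ * (2 * P α d)))
        = fun τ => ∑ α ∈ A, (b α * (2 * P α d)) * Real.exp (2 * P α y + τ * (2 * P α d)) := by
      intro b
      funext τ
      refine HasDerivAt.deriv (HasDerivAt.fun_sum fun α _ => ?_)
      have h1 : HasDerivAt (fun τ : ℝ => 2 * P α y + τ * (2 * P α d)) (2 * P α d) τ := by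
        simpa using ((hasDerivAt_id τ).mul_const (2 * P α d)).const_add (2 * P α y)
      have h2 := h1.exp.const_mul (b α)
      rwa [mul_comm (Real.exp _), ← mul_assoc] at h2
    have hdiff : ∀ b : (Fin n → ℕ) → ℝ, Differentiable ℝ (fun τ : ℝ =>
        ∑ α ∈ A, b α * Real.exp (2 * P α y + τ * (2 * P α d))) := by
      intro b
      fun_prop
    have hconv : ConvexOn ℝ univ φ := by
      refine convexOn_univ_of_deriv2_nonneg (hdiff c) ?_ ?_
      · rw [hφ, hderiv]
        exact hdiff _
      · intro τ
        rw [Function.iterate_succ, Function.iterate_one, Function.comp, hφ, hderiv, hderiv]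
        have h1 := hlevi (y + τ • d) d
        have h2 : ∑ α ∈ A, c α * (2 * P α d) * (2 * P α d) *
              Real.exp (2 * P α y + τ * (2 * P α d))
            = 4 * ∑ α ∈ A, c α * Real.exp (2 * P α (y + τ • d)) * P α d ^ 2 := by
          rw [Finset.mul_sum]
          refine Finset.sum_congr rfl fun α _ => ?_
          rw [hPadd, hPsmul]
          ring_nf
        exact (mul_nonneg zero_le_four h1).trans_eq h2.symm
    have h1 := hconv.2 (mem_univ 0) (mem_univ 1) (show (0 : ℝ) ≤ 1 / 2 by norm_num)
      (show (0 : ℝ) ≤ 1 / 2 by norm_num) (by norm_num)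
    have e0 : g y = φ 0 := by rw [← hgφ, zero_smul, add_zero]
    have e1 : g (y + d) = φ 1 := by rw [← hgφ, one_smul]
    rw [hgφ, e0, e1]
    simp only [smul_eq_mul, mul_zero, mul_one, zero_add] at h1
    linarith
  have hhom : ∀ (s : ℝ) y, g (y + s • fun j => (a j : ℝ)) = Real.exp (s * l) * g y := by
    intro s y
    rw [hg, Finset.mul_sum]
    refine Finset.sum_congr rfl fun α hα => ?_
    rw [hPadd, hPsmul, ← hPa α hα, mul_left_comm, ← Real.exp_add]
    ring_nf
  obtain ⟨y₀, hy₀⟩ : ∃ y₀, g y₀ = 0 :=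
    ⟨_, (hlog (fun j => ‖z₀ j‖) fun j => norm_pos_iff.2 (hz₀ j)).symm.trans h0⟩
  have hzero : ∀ d, g (y₀ + (1 / 2 : ℝ) • d) = 0 := by
    intro d
    refine le_antisymm ?_ (hnonneg _)
    -- Sliding the endpoints by `-s a` and `s a` keeps the midpoint fixed. The first endpoint stays
    -- a zero by homogeneity, and the value at the second is scaled by `exp(s l)`.
    have hbound : ∀ s : ℝ, g (y₀ + (1 / 2 : ℝ) • d) ≤ Real.exp (s * l) * g (y₀ + d) / 2 := by
      intro s
      have h1 := hmid (y₀ + (-s) • fun j => (a j : ℝ)) (d + (2 * s) • fun j => (a j : ℝ))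
      have e1 : y₀ + (-s) • (fun j => (a j : ℝ)) + (1 / 2 : ℝ) • (d + (2 * s) • fun j => (a j : ℝ))
          = y₀ + (1 / 2 : ℝ) • d := by
        module
      have e2 : y₀ + (-s) • (fun j => (a j : ℝ)) + (d + (2 * s) • fun j => (a j : ℝ))
          = y₀ + d + s • fun j => (a j : ℝ) := by
        module
      rw [e1, e2, hhom, hhom, hy₀] at h1
      linarith
    have hlpos : (0 : ℝ) < l := by positivity
    have hlim : Tendsto (fun s : ℝ => Real.exp (s * l) * g (y₀ + d) / 2) atBot (𝓝 0) := by
      have h1 : Tendsto (fun s : ℝ => Real.exp (s * l)) atBot (𝓝 0) :=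
        Real.tendsto_exp_atBot.comp (tendsto_id.atBot_mul_const hlpos)
      simpa using (h1.mul_const (g (y₀ + d))).div_const 2
    exact ge_of_tendsto hlim (Eventually.of_forall hbound)
  rw [hlog x hx]
  have := hzero ((2 : ℝ) • ((fun j => Real.log (x j)) - y₀))
  rwa [show y₀ + (1 / 2 : ℝ) • (2 : ℝ) • ((fun j => Real.log (x j)) - y₀)
    = fun j => Real.log (x j) by module] at this

end Convexity

/-! ### The part of lowest weight as a limit of dilations. -/

section LowestWeight

variable {n : ℕ}

/-- The weight `⟨a, α + β⟩`. -/
def weight (a α β : Fin n → ℕ) : ℕ := ∑ j, a j * (α j + β j)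

/-- The anisotropic dilation `(s^{a_1} z_1, …, s^{a_n} z_n)`. -/
noncomputable def dilate (a : Fin n → ℕ) (s : ℝ) (z : Fin n → ℂ) : Fin n → ℂ :=
  fun j => (s : ℂ) ^ a j * z j

theorem dilate_add_smul (a : Fin n → ℕ) (s : ℝ) (z v : Fin n → ℂ) (t : ℂ) :
    dilate a s (z + t • v) = dilate a s z + t • dilate a s v := by
  funext j
  simp only [dilate, Pi.add_apply, Pi.smul_apply, smul_eq_mul]
  ring

theorem norm_dilate_le {a : Fin n → ℕ} (ha : ∀ j, 1 ≤ a j) {s : ℝ} (h0 : 0 ≤ s) (h1 : s ≤ 1)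
    (z : Fin n → ℂ) : ‖dilate a s z‖ ≤ s * ‖z‖ := by
  refine (pi_norm_le_iff_of_nonneg (by positivity)).2 fun j => ?_
  rw [dilate, norm_mul, norm_pow, Complex.norm_real, Real.norm_eq_abs, abs_of_nonneg h0]
  gcongr
  · exact pow_le_of_le_one h0 h1 (by have := ha j; omega)
  · exact norm_le_pi_norm z j

theorem mixedMonomial_dilate (a α β : Fin n → ℕ) (s : ℝ) (z : Fin n → ℂ) :
    mixedMonomial α β (dilate a s z) = (s : ℂ) ^ weight a α β * mixedMonomial α β z := by
  simp only [mixedMonomial, dilate, map_mul, map_pow, Complex.conj_ofReal, weight,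
    ← Finset.prod_pow_eq_pow_sum, mul_pow, ← pow_mul, Finset.prod_mul_distrib, mul_add, pow_add]
  ring

theorem norm_mixedMonomial_le (α β : Fin n → ℕ) {R : ℝ} {z : Fin n → ℂ} (hz : ‖z‖ ≤ R) :
    ‖mixedMonomial α β z‖ ≤ (∏ j, R ^ α j) * ∏ j, R ^ β j := by
  have hj : ∀ j, ‖z j‖ ≤ R := fun j => (norm_le_pi_norm z j).trans hz
  have hR : 0 ≤ R := (norm_nonneg z).trans hz
  rw [mixedMonomial, norm_mul, norm_prod, norm_prod]
  simp only [norm_pow, RCLike.norm_conj]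
  refine mul_le_mul ?_ ?_ (by positivity) (by positivity) <;>
  · refine Finset.prod_le_prod (fun _ _ => by positivity) fun j _ => ?_
    have := hj j
    gcongr

/-- A box of multi-indices containing all those of order at most `l`. -/
def indexBox (n l : ℕ) : Finset ((Fin n → ℕ) × (Fin n → ℕ)) :=
  (Fintype.piFinset fun _ => Finset.range (l + 1)) ×ˢ
    (Fintype.piFinset fun _ => Finset.range (l + 1))

theorem mem_indexBox {l : ℕ} {α β : Fin n → ℕ} :
    (α, β) ∈ indexBox n l ↔ (∀ j, α j ≤ l) ∧ ∀ j, β j ≤ l := by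
  simp [indexBox]

/-- The part of weight `l` of the Taylor expansion of `F`. -/
noncomputable def weightedPart (F : (Fin n → ℂ) → ℝ) (a : Fin n → ℕ) (l : ℕ)
    (z : Fin n → ℂ) : ℂ :=
  ∑ q ∈ indexBox n l with weight a q.1 q.2 = l,
    taylorCoeff F q.1 q.2 * mixedMonomial q.1 q.2 z

theorem continuous_weightedPart (F : (Fin n → ℂ) → ℝ) (a : Fin n → ℕ) (l : ℕ) :
    Continuous (weightedPart F a l) :=
  continuous_finsetSum _ fun q _ =>
    continuous_const.mul (contDiff_mixedMonomial q.1 q.2).continuous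

/-- Dilations of `F` converge to its part of lowest weight, uniformly on balls. -/
theorem dilation_approx {F : (Fin n → ℂ) → ℝ} (hF : SmoothGerm F 0) {a : Fin n → ℕ}
    (ha : ∀ j, 1 ≤ a j) {l : ℕ} (hval : ∀ α β, taylorCoeff F α β ≠ 0 → l ≤ weight a α β)
    {R : ℝ} (hR : 0 < R) :
    ∃ C : ℝ, ∀ᶠ s in 𝓝[>] (0 : ℝ), ∀ z : Fin n → ℂ, ‖z‖ ≤ R →
      ‖((F (dilate a s z) / s ^ l : ℝ) : ℂ) - weightedPart F a l z‖ ≤ C * s := by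
  -- Order `l + 1` suffices: since every `a_j` is at least `1`, the dilated remainder is `O(s^(l +
  -- 1))`, one power better than the normalization `s^l`.
  obtain ⟨C, hC⟩ := taylor_formula hF (l + 1) (indexBox n l) fun α β h => by
    rw [mem_indexBox]
    constructor <;> intro j
    · have := Finset.single_le_sum (f := α) (fun _ _ => Nat.zero_le _) (Finset.mem_univ j)
      omega
    · have := Finset.single_le_sum (f := β) (fun _ _ => Nat.zero_le _) (Finset.mem_univ j)
      omega
  obtain ⟨ε, hε, hball⟩ := Metric.eventually_nhds_iff_ball.1 hC
  set B : ℝ := ∑ q ∈ indexBox n l,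
    ‖taylorCoeff F q.1 q.2‖ * ((∏ j, R ^ q.1 j) * ∏ j, R ^ q.2 j) with hB
  refine ⟨|C| * R ^ (l + 1) + B, ?_⟩
  filter_upwards [self_mem_nhdsWithin, Ioo_mem_nhdsGT (show (0 : ℝ) < min 1 (ε / R) by positivity)]
    with s (hs : 0 < s) hs' z hz
  have hs1 : s ≤ 1 := (hs'.2.trans_le (min_le_left _ _)).le
  have hsR : s * R < ε := (lt_div_iff₀ hR).1 (hs'.2.trans_le (min_le_right _ _))
  have hdil : ‖dilate a s z‖ ≤ s * R :=
    (norm_dilate_le ha hs.le hs1 z).trans (by gcongr)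
  have h1 := hball (dilate a s z) (by simpa using hdil.trans_lt hsR)
  have h2 : ‖(F (dilate a s z) : ℂ) - ∑ q ∈ indexBox n l,
      taylorCoeff F q.1 q.2 * mixedMonomial q.1 q.2 (dilate a s z)‖
      ≤ |C| * R ^ (l + 1) * s ^ (l + 1) := by
    refine h1.trans ?_
    calc C * ‖dilate a s z‖ ^ (l + 1) ≤ |C| * (s * R) ^ (l + 1) := by
          gcongr
          exact le_abs_self C
      _ = _ := by ring
  -- Weights are integers, so nonzero terms of the Taylor polynomial of weight other than `l` have
  -- weight at least `l + 1`.
  have h3 : ‖∑ q ∈ indexBox n l, taylorCoeff F q.1 q.2 * mixedMonomial q.1 q.2 (dilate a s z)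
      - (s : ℂ) ^ l * weightedPart F a l z‖ ≤ B * s ^ (l + 1) := by
    rw [weightedPart, Finset.sum_filter, Finset.mul_sum, ← Finset.sum_sub_distrib, hB,
      Finset.sum_mul]
    refine (norm_sum_le _ _).trans (Finset.sum_le_sum fun q _ => ?_)
    rw [mixedMonomial_dilate]
    split_ifs with hw
    · rw [hw]
      ring_nf
      rw [norm_zero]
      positivity
    · rw [mul_zero, sub_zero]
      by_cases h0 : taylorCoeff F q.1 q.2 = 0
      · simp [h0]
      · have hlt : l + 1 ≤ weight a q.1 q.2 := by
          have := hval _ _ h0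
          omega
        rw [norm_mul, norm_mul, norm_pow, Complex.norm_real, Real.norm_eq_abs, abs_of_pos hs,
          mul_assoc]
        refine mul_le_mul_of_nonneg_left ?_ (norm_nonneg _)
        rw [mul_comm]
        exact mul_le_mul (norm_mixedMonomial_le q.1 q.2 hz) (pow_le_pow_of_le_one hs.le hs1 hlt)
          (by positivity) (by positivity)
  have hsl : (0 : ℝ) < s ^ l := by positivity
  have hsl' : (s : ℂ) ^ l ≠ 0 := pow_ne_zero _ (by exact_mod_cast hs.ne')
  have h4 : ‖(F (dilate a s z) : ℂ) - (s : ℂ) ^ l * weightedPart F a l z‖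
      ≤ (|C| * R ^ (l + 1) + B) * s ^ (l + 1) := by
    rw [add_mul]
    exact (norm_sub_le_norm_sub_add_norm_sub _ _ _).trans (add_le_add h2 h3)
  have h5 : ((F (dilate a s z) / s ^ l : ℝ) : ℂ) - weightedPart F a l z
      = ((F (dilate a s z) : ℂ) - (s : ℂ) ^ l * weightedPart F a l z) / (s : ℂ) ^ l := by
    push_cast
    field_simp
  rw [h5, norm_div, norm_pow, Complex.norm_real, Real.norm_eq_abs, abs_of_pos hs,
    div_le_iff₀ hsl]
  refine h4.trans_eq ?_
  ring

/-- It is a limit of the real quotients `F(s^a z) / s^l`. -/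
theorem weightedPart_im {F : (Fin n → ℂ) → ℝ} (hF : SmoothGerm F 0) {a : Fin n → ℕ}
    (ha : ∀ j, 1 ≤ a j) {l : ℕ} (hval : ∀ α β, taylorCoeff F α β ≠ 0 → l ≤ weight a α β)
    (z : Fin n → ℂ) : (weightedPart F a l z).im = 0 := by
  obtain ⟨C, hC⟩ := dilation_approx hF ha hval (R := ‖z‖ + 1) (by positivity)
  have hlim : Tendsto (fun s : ℝ => C * s) (𝓝[>] 0) (𝓝 0) := by
    have : Tendsto (fun s : ℝ => C * s) (𝓝 0) (𝓝 (C * 0)) := tendsto_id.const_mul C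
    rw [mul_zero] at this
    exact this.mono_left nhdsWithin_le_nhds
  have h : |(weightedPart F a l z).im| ≤ 0 := by
    refine ge_of_tendsto hlim ?_
    filter_upwards [hC] with s hs
    have h1 := (Complex.abs_im_le_norm _).trans (hs z (by linarith))
    rwa [Complex.sub_im, Complex.ofReal_im, zero_sub, abs_neg] at h1
  exact abs_eq_zero.1 (le_antisymm h (abs_nonneg _))

/-- The lowest weight part of a plurisubharmonic function is plurisubharmonic. -/
theorem weightedPart_subMean {F : (Fin n → ℂ) → ℝ} (hF : SmoothGerm F 0)
    (hpsh : IsPlurisubharmonicGerm F) {a : Fin n → ℕ} (ha : ∀ j, 1 ≤ a j) {l : ℕ}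
    (hval : ∀ α β, taylorCoeff F α β ≠ 0 → l ≤ weight a α β) (z v : Fin n → ℂ) :
    (weightedPart F a l z).re
      ≤ Real.circleAverage (fun t : ℂ => (weightedPart F a l (z + t • v)).re) 0 1 := by
  have hR : 0 < ‖z‖ + ‖v‖ + 1 := by positivity
  have hdisc : ∀ t : ℂ, ‖t‖ ≤ 1 → ‖z + t • v‖ ≤ ‖z‖ + ‖v‖ + 1 := by
    intro t ht
    have h1 : ‖t • v‖ ≤ ‖v‖ := by
      rw [norm_smul]
      exact mul_le_of_le_one_left (norm_nonneg _) ht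
    linarith [norm_add_le z (t • v)]
  obtain ⟨C, hC⟩ := dilation_approx hF ha hval hR
  obtain ⟨V, hV, h0V, hFV⟩ := hF
  obtain ⟨U, hU, h0U, -, hsub⟩ := hpsh
  obtain ⟨ε, hε, hball⟩ := Metric.isOpen_iff.1 (hU.inter hV) 0 ⟨h0U, h0V⟩
  set A := Real.circleAverage (fun t : ℂ => (weightedPart F a l (z + t • v)).re) 0 1 with hA
  have hcont : Continuous fun t : ℂ => (weightedPart F a l (z + t • v)).re := by
    have := continuous_weightedPart F a l
    fun_prop
  -- The error `C * s` enters twice, once at the centre of the disc and once in the average over its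
  -- boundary.
  have hlim : Tendsto (fun s : ℝ => A + 2 * C * s) (𝓝[>] 0) (𝓝 A) := by
    have : Tendsto (fun s : ℝ => A + 2 * C * s) (𝓝 0) (𝓝 (A + 2 * C * 0)) :=
      (tendsto_id.const_mul (2 * C)).const_add A
    rw [mul_zero, add_zero] at this
    exact this.mono_left nhdsWithin_le_nhds
  refine ge_of_tendsto hlim ?_
  filter_upwards [hC, self_mem_nhdsWithin, Ioo_mem_nhdsGT
    (show (0 : ℝ) < min 1 (ε / (‖z‖ + ‖v‖ + 1)) by positivity)] with s hs (hs0 : 0 < s) hs'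
  have hs1 : s ≤ 1 := (hs'.2.trans_le (min_le_left _ _)).le
  have hsR : s * (‖z‖ + ‖v‖ + 1) < ε := (lt_div_iff₀ hR).1 (hs'.2.trans_le (min_le_right _ _))
  have hmem : ∀ t : ℂ, ‖t‖ ≤ 1 → dilate a s z + t • dilate a s v ∈ U ∩ V := by
    intro t ht
    rw [← dilate_add_smul]
    refine hball ?_
    rw [mem_ball_zero_iff]
    refine ((norm_dilate_le ha hs0.le hs1 _).trans ?_).trans_lt hsR
    have := hdisc t ht
    gcongr
  have hsl : (0 : ℝ) < s ^ l := by positivity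
  have h1 := hsub (dilate a s z) (dilate a s v) fun t ht => (hmem t ht).1
  have hi1 : CircleIntegrable (fun t : ℂ => F (dilate a s z + t • dilate a s v)) 0 1 := by
    refine ContinuousOn.circleIntegrable' (hFV.continuousOn.comp
      (Continuous.continuousOn (by fun_prop)) fun t ht => (hmem t ?_).2)
    simpa using (mem_sphere_zero_iff_norm.1 ht).le
  have hi2 : CircleIntegrable (fun t : ℂ => s ^ l • ((weightedPart F a l (z + t • v)).re + C * s))
      0 1 := by
    refine ContinuousOn.circleIntegrable' (Continuous.continuousOn ?_)
    fun_prop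
  have hreal : ∀ w : Fin n → ℂ, ‖w‖ ≤ ‖z‖ + ‖v‖ + 1 →
      |F (dilate a s w) / s ^ l - (weightedPart F a l w).re| ≤ C * s := by
    intro w hw
    have h := (Complex.abs_re_le_norm _).trans (hs w hw)
    rwa [Complex.sub_re, Complex.ofReal_re] at h
  have h2 : Real.circleAverage (fun t : ℂ => F (dilate a s z + t • dilate a s v)) 0 1
      ≤ Real.circleAverage
        (fun t : ℂ => s ^ l • ((weightedPart F a l (z + t • v)).re + C * s)) 0 1 := by
    refine Real.circleAverage_mono hi1 hi2 fun t ht => ?_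
    have ht' : ‖t‖ ≤ 1 := by simpa using (mem_sphere_zero_iff_norm.1 ht).le
    have h := (abs_le.1 (hreal _ (hdisc t ht'))).2
    rw [← dilate_add_smul, smul_eq_mul, mul_comm, ← div_le_iff₀ hsl]
    linarith
  have hA' : Real.circleAverage
      (fun t : ℂ => s ^ l • ((weightedPart F a l (z + t • v)).re + C * s)) 0 1
      = s ^ l * (A + C * s) := by
    rw [Real.circleAverage_fun_smul, Real.circleAverage_fun_add
      hcont.continuousOn.circleIntegrable' (continuous_const.continuousOn.circleIntegrable'),
      Real.circleAverage_const, smul_eq_mul]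
  have h3 := h1.trans (h2.trans_eq hA')
  have h4 : F (dilate a s z) / s ^ l ≤ A + C * s := by
    rwa [div_le_iff₀ hsl, mul_comm]
  have h5 := (abs_le.1 (hreal z (by linarith [norm_nonneg v]))).1
  linarith

theorem mixedMonomial_self (α : Fin n → ℕ) (z : Fin n → ℂ) :
    mixedMonomial α α z = ((∏ j, ‖z j‖ ^ (2 * α j) : ℝ) : ℂ) := by
  rw [mixedMonomial, ← Finset.prod_mul_distrib, Complex.ofReal_prod]
  refine Finset.prod_congr rfl fun j _ => ?_
  rw [← mul_pow, Complex.mul_conj', ← pow_mul]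
  push_cast
  rfl

/-- The exponents `α` with `z^α z̄^α` of weight `l`. -/
def diagonalIndices (a : Fin n → ℕ) (l : ℕ) : Finset (Fin n → ℕ) :=
  {α ∈ Fintype.piFinset fun _ => Finset.range (l + 1) | weight a α α = l}

/-- With only diagonal terms left, the function depends on the moduli `‖z j‖` alone. This serves
both the convexity argument and the rotation of the curve parameter in the final proof. -/
theorem weightedPart_eq_sum_diagonal {F : (Fin n → ℂ) → ℝ} {a : Fin n → ℕ} {l : ℕ}
    (hdiag : ∀ α β, taylorCoeff F α β ≠ 0 → weight a α β = l → α = β) (z : Fin n → ℂ) :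
    weightedPart F a l z = ∑ α ∈ diagonalIndices a l,
      taylorCoeff F α α * ((∏ j, ‖z j‖ ^ (2 * α j) : ℝ) : ℂ) := by
  have hinj : ∀ α ∈ diagonalIndices a l, ∀ β ∈ diagonalIndices a l,
      (fun γ : Fin n → ℕ => (γ, γ)) α = (fun γ => (γ, γ)) β → α = β :=
    fun α _ β _ h => (Prod.mk.inj h).1
  rw [weightedPart]
  simp only [← mixedMonomial_self]
  rw [← Finset.sum_image (g := fun γ : Fin n → ℕ => (γ, γ))
    (f := fun q => taylorCoeff F q.1 q.2 * mixedMonomial q.1 q.2 z) hinj]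
  refine (Finset.sum_subset ?_ ?_).symm
  · intro q hq
    obtain ⟨α, hα, rfl⟩ := Finset.mem_image.1 hq
    simp only [diagonalIndices, Finset.mem_filter, Fintype.mem_piFinset, Finset.mem_range] at hα
    rw [Finset.mem_filter, mem_indexBox]
    exact ⟨⟨fun j => by have := hα.1 j; omega, fun j => by have := hα.1 j; omega⟩, hα.2⟩
  · rintro ⟨α, β⟩ hq hq'
    rw [Finset.mem_filter, mem_indexBox] at hq
    by_contra hne
    have h0 : taylorCoeff F α β ≠ 0 := left_ne_zero_of_mul hne
    obtain rfl := hdiag α β h0 hq.2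
    refine hq' (Finset.mem_image.2 ⟨α, ?_, rfl⟩)
    simp only [diagonalIndices, Finset.mem_filter, Fintype.mem_piFinset, Finset.mem_range]
    exact ⟨fun j => by have := hq.1.1 j; omega, hq.2⟩

theorem weight_pos_coord {a : Fin n → ℕ} (ha : ∀ j, 1 ≤ a j) (α β : Fin n → ℕ) (j : Fin n) :
    α j + β j ≤ weight a α β :=
  (Nat.le_mul_of_pos_left _ (ha j)).trans
    (Finset.single_le_sum (f := fun j => a j * (α j + β j)) (fun _ _ => Nat.zero_le _)
      (Finset.mem_univ j))

/-- Since the weights are positive, no index of weight `l` escapes the box, so `weightedPart` misses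
no term. -/
theorem mem_indexBox_of_weight_le {a : Fin n → ℕ} (ha : ∀ j, 1 ≤ a j) {α β : Fin n → ℕ} {l : ℕ}
    (h : weight a α β ≤ l) : (α, β) ∈ indexBox n l := by
  rw [mem_indexBox]
  constructor <;> intro j <;> have := weight_pos_coord ha α β j <;> omega

theorem taylorCoeff_zero_zero (F : (Fin n → ℂ) → ℝ) : taylorCoeff F 0 0 = F 0 := by
  rw [taylorCoeff_eq, jet_zero]
  simp

/-- If the lowest weight part of a plurisubharmonic germ is invariant under the rotation, it has no
zeros off the coordinate hyperplanes. -/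
theorem weightedPart_ne_zero {F : (Fin n → ℂ) → ℝ} (hF : SmoothGerm F 0) (hF0 : F 0 = 0)
    (hpsh : IsPlurisubharmonicGerm F) {a : Fin n → ℕ} (ha : ∀ j, 1 ≤ a j) {l : ℕ}
    (hval : ∀ α β, taylorCoeff F α β ≠ 0 → l ≤ weight a α β)
    (hdiag : ∀ α β, taylorCoeff F α β ≠ 0 → weight a α β = l → α = β)
    {α β : Fin n → ℕ} (hαβ : taylorCoeff F α β ≠ 0) (hw : weight a α β = l)
    {c : Fin n → ℂ} (hc : ∀ j, c j ≠ 0) : weightedPart F a l c ≠ 0 := by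
  intro hzero
  -- Only the constant term has weight zero, and it vanishes because `F 0 = 0`.
  have hl : l ≠ 0 := by
    rintro rfl
    have hα : α = 0 := by
      ext j
      have := weight_pos_coord ha α β j
      simp only [Pi.zero_apply]
      omega
    have hβ : β = 0 := by
      ext j
      have := weight_pos_coord ha α β j
      simp only [Pi.zero_apply]
      omega
    rw [hα, hβ, taylorCoeff_zero_zero, hF0] at hαβ
    exact hαβ Complex.ofReal_zero
  have hre : ∀ z, (weightedPart F a l z).re
      = ∑ α ∈ diagonalIndices a l, (taylorCoeff F α α).re * ∏ j, ‖z j‖ ^ (2 * α j) := by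
    intro z
    rw [weightedPart_eq_sum_diagonal hdiag, Complex.re_sum]
    simp only [Complex.re_mul_ofReal]
  have hsub := weightedPart_subMean hF hpsh ha hval
  simp only [hre] at hsub
  have h0 : ∑ α ∈ diagonalIndices a l, (taylorCoeff F α α).re * ∏ j, ‖c j‖ ^ (2 * α j) = 0 := by
    rw [← hre, hzero, Complex.zero_re]
  have hoff : ∀ z : Fin n → ℂ, (∀ j, z j ≠ 0) → weightedPart F a l z = 0 := by
    intro z hz
    refine Complex.ext ?_ (weightedPart_im hF ha hval z)
    rw [hre, Complex.zero_re]
    refine sum_eq_zero_of_exists_zero _ _ a hl ?_ hsub hc h0 (x := fun j => ‖z j‖)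
      fun j => norm_pos_iff.2 (hz j)
    intro γ hγ
    rw [← (Finset.mem_filter.1 hγ).2, weight]
    simp only [two_mul]
  -- The complement of the coordinate hyperplanes is dense, so continuity extends the vanishing
  -- everywhere.
  have hall : weightedPart F a l = fun _ => 0 := by
    have hd : Dense (Set.pi univ fun _ : Fin n => ({0}ᶜ : Set ℂ)) :=
      dense_pi _ fun _ _ => dense_compl_singleton 0
    refine (continuous_weightedPart F a l).ext_on hd continuous_const fun z hz => ?_
    exact hoff z fun j => hz j (mem_univ j)
  refine hαβ (coeff_eq_zero_of_sum_mixedMonomial_eq_zero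
    {q ∈ indexBox n l | weight a q.1 q.2 = l} (fun q => taylorCoeff F q.1 q.2)
    (fun z => congrFun hall z) (α, β) ?_)
  exact Finset.mem_filter.2 ⟨mem_indexBox_of_weight_le ha hw.le, hw⟩

end LowestWeight

/-! ### Newton polyhedra, bounded faces and the principal part. -/

section NewtonPolyhedron

variable {m : ℕ}

theorem mem_newtonPolyhedron_of_le {F : (Fin m → ℂ) → ℝ} {α β : Fin m → ℕ}
    (h : taylorCoeff F α β ≠ 0) {ξ : Fin m → ℝ} (hξ : ∀ j, exponent α β j ≤ ξ j) :
    ξ ∈ newtonPolyhedron F :=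
  subset_convexHull ℝ _ (mem_iUnion₂.2 ⟨_, ⟨α, β, h, rfl⟩, hξ⟩)

theorem exponent_mem_newtonPolyhedron {F : (Fin m → ℂ) → ℝ} {α β : Fin m → ℕ}
    (h : taylorCoeff F α β ≠ 0) : exponent α β ∈ newtonPolyhedron F :=
  mem_newtonPolyhedron_of_le h fun _ => le_rfl

theorem sum_mul_exponent (a α β : Fin m → ℕ) :
    ∑ j, ((a j : ℤ) : ℝ) * exponent α β j = ((weight a α β : ℤ) : ℝ) := by
  simp [exponent, weight]

/-- A half-space is convex, and `a ≥ 0` lets an inequality at an exponent pass to its whole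
translated orthant. -/
theorem le_on_newtonPolyhedron {F : (Fin m → ℂ) → ℝ} {a : Fin m → ℕ} {l : ℤ}
    (h : ∀ α β, taylorCoeff F α β ≠ 0 → l ≤ weight a α β) {ξ : Fin m → ℝ}
    (hξ : ξ ∈ newtonPolyhedron F) : (l : ℝ) ≤ ∑ j, ((a j : ℤ) : ℝ) * ξ j := by
  have hconv : Convex ℝ {ξ : Fin m → ℝ | (l : ℝ) ≤ ∑ j, ((a j : ℤ) : ℝ) * ξ j} := by
    refine convex_halfSpace_ge ⟨fun x y => ?_, fun c x => ?_⟩ _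
    · simp [mul_add, Finset.sum_add_distrib]
    · simp only [Pi.smul_apply, smul_eq_mul, Finset.mul_sum]
      exact Finset.sum_congr rfl fun j _ => by ring
  refine convexHull_min ?_ hconv hξ
  refine iUnion₂_subset ?_
  rintro s ⟨α, β, hαβ, rfl⟩ η hη
  have h1 : (l : ℝ) ≤ ((weight a α β : ℤ) : ℝ) := by exact_mod_cast h α β hαβ
  rw [mem_ofPred_eq]
  refine h1.trans ?_
  rw [← sum_mul_exponent]
  exact Finset.sum_le_sum fun j _ => mul_le_mul_of_nonneg_left (hη j) (by positivity)

theorem nonneg_of_mem_newtonPolyhedron {F : (Fin m → ℂ) → ℝ} {ξ : Fin m → ℝ}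
    (hξ : ξ ∈ newtonPolyhedron F) : 0 ≤ ξ := by
  refine convexHull_min ?_ (convex_Ici (𝕜 := ℝ) (0 : Fin m → ℝ)) hξ
  refine iUnion₂_subset ?_
  rintro s ⟨α, β, -, rfl⟩ η hη j
  exact (Nat.cast_nonneg (α j + β j)).trans (hη j)

/-- Data of a nonempty face determined by a positive vector: all exponents have weight at least
`l`, and some exponent has weight `l`. -/
theorem CutsOut.exists_weight_eq {F : (Fin m → ℂ) → ℝ} {a : Fin m → ℕ} {l : ℤ}
    {κ : Set (Fin m → ℝ)} (h : CutsOut (newtonPolyhedron F) (fun j => (a j : ℤ)) l κ)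
    (hκ : κ.Nonempty) :
    ∃ k : ℕ, l = k ∧ (∀ α β, taylorCoeff F α β ≠ 0 → k ≤ weight a α β) ∧
      ∃ α β, taylorCoeff F α β ≠ 0 ∧ weight a α β = k := by
  have hval : ∀ α β, taylorCoeff F α β ≠ 0 → l ≤ weight a α β := by
    intro α β hαβ
    have := h.1 _ (exponent_mem_newtonPolyhedron hαβ)
    rw [sum_mul_exponent] at this
    exact_mod_cast this
  obtain ⟨α, β, hαβ, hw⟩ : ∃ α β, taylorCoeff F α β ≠ 0 ∧ (weight a α β : ℤ) = l := by
    -- By integrality, if no exponent had weight `l`, all weights would be at least `l + 1`; the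
    -- same bound would hold on the polyhedron and the face would be empty.
    by_contra! hne
    obtain ⟨ξ, hξ⟩ := hκ
    rw [h.2] at hξ
    have h1 := le_on_newtonPolyhedron (a := a) (l := l + 1) (fun α β hαβ => by
      have := hval α β hαβ
      have := hne α β hαβ
      omega) hξ.1
    rw [hξ.2] at h1
    push_cast at h1
    linarith
  refine ⟨weight a α β, hw.symm, fun α' β' h' => ?_, α, β, hαβ, rfl⟩
  have := hval α' β' h'
  omega

/-- A positive vector cuts a bounded slice from the nonnegative orthant, so the face it determines
is bounded. -/
theorem exponent_mem_newtonDiagram {F : (Fin m → ℂ) → ℝ} {a : Fin m → ℕ} (ha : ∀ j, 1 ≤ a j)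
    {l : ℕ} (hval : ∀ α β, taylorCoeff F α β ≠ 0 → l ≤ weight a α β) {α β : Fin m → ℕ}
    (hαβ : taylorCoeff F α β ≠ 0) (hw : weight a α β = l) :
    exponent α β ∈ newtonDiagram F := by
  refine ⟨{ξ ∈ newtonPolyhedron F | ∑ j, ((a j : ℤ) : ℝ) * ξ j = (l : ℤ)},
    ⟨fun j => (a j : ℤ), l, fun ξ hξ => ?_, rfl⟩, ?_, exponent_mem_newtonPolyhedron hαβ, ?_⟩
  · exact le_on_newtonPolyhedron (fun α β h => by exact_mod_cast hval α β h) hξ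
  · refine (Metric.isBounded_Icc (0 : Fin m → ℝ) fun _ => (l : ℝ)).subset ?_
    rintro ξ ⟨hξ, hl⟩
    have h0 := nonneg_of_mem_newtonPolyhedron hξ
    refine ⟨h0, fun j => ?_⟩
    have h1 := Finset.single_le_sum (f := fun j => ((a j : ℤ) : ℝ) * ξ j)
      (fun i _ => mul_nonneg (by positivity) (h0 i)) (Finset.mem_univ j)
    have h2 : (1 : ℝ) ≤ ((a j : ℤ) : ℝ) := by exact_mod_cast ha j
    have h3 : ξ j ≤ ((a j : ℤ) : ℝ) * ξ j := le_mul_of_one_le_left (h0 j) h2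
    rw [hl] at h1
    exact_mod_cast h3.trans h1
  · rw [sum_mul_exponent, hw]

/-- Exponents on the Newton diagram are minimal in the support. -/
theorem eq_of_le_of_mem_newtonDiagram {F : (Fin m → ℂ) → ℝ} {α β α' β' : Fin m → ℕ}
    (h : taylorCoeff F α β ≠ 0) (hmem : exponent α β ∈ newtonDiagram F)
    (h' : taylorCoeff F α' β' ≠ 0) (hle : α' + β' ≤ α + β) : α' + β' = α + β := by
  obtain ⟨κ, ⟨a, l, hval, rfl⟩, hbdd, hκ⟩ := hmem
  have hray : ∀ (j : Fin m) (t : ℝ), 0 ≤ t →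
      exponent α β + t • (Pi.single j 1 : Fin m → ℝ) ∈ newtonPolyhedron F := by
    intro j t ht
    refine mem_newtonPolyhedron_of_le h fun i => ?_
    have : (0 : ℝ) ≤ (Pi.single j 1 : Fin m → ℝ) i := by
      by_cases hi : i = j
      · subst hi; simp
      · simp [hi]
    simp only [Pi.add_apply, Pi.smul_apply, smul_eq_mul, le_add_iff_nonneg_right]
    positivity
  have hsum : ∀ (j : Fin m) (t : ℝ),
      ∑ i, (a i : ℝ) * (exponent α β + t • (Pi.single j 1 : Fin m → ℝ)) i = l + t * a j := by
    intro j t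
    simp only [Pi.add_apply, Pi.smul_apply, smul_eq_mul, mul_add, Finset.sum_add_distrib]
    rw [hκ.2, Finset.sum_eq_single j (fun i _ hi => by simp [hi]) (by simp)]
    simp [mul_comm]
  -- A negative `a j` would violate validity along the ray in direction `e_j`, and `a j = 0` would
  -- put that ray inside the bounded face.
  have hpos : ∀ j, 0 < a j := by
    intro j
    have h0 : 0 ≤ a j := by
      have h1 := hval _ (hray j 1 zero_le_one)
      rw [hsum] at h1
      have : (0 : ℝ) ≤ a j := by linarith
      exact_mod_cast this
    refine lt_of_le_of_ne h0 fun h1 => ?_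
    obtain ⟨R, hR⟩ := hbdd.exists_norm_le
    have h2 := hR _ ⟨hray j (|R| + 1) (by positivity), by rw [hsum, ← h1]; simp⟩
    have h3 := (norm_le_pi_norm _ j).trans h2
    simp only [Pi.add_apply, Pi.smul_apply, Pi.single_eq_same, smul_eq_mul, mul_one,
      Real.norm_eq_abs] at h3
    have h4 : (0 : ℝ) ≤ exponent α β j := Nat.cast_nonneg _
    have h5 := (le_abs_self _).trans h3
    linarith [le_abs_self R]
  have h1 := hval _ (exponent_mem_newtonPolyhedron h')
  rw [← hκ.2] at h1
  have hterm : ∀ j, (a j : ℝ) * exponent α' β' j ≤ (a j : ℝ) * exponent α β j := by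
    intro j
    have : (0 : ℝ) < a j := by exact_mod_cast hpos j
    have : exponent α' β' j ≤ exponent α β j := by
      have := hle j
      simp only [exponent]
      exact_mod_cast this
    gcongr
  have heq := (Finset.sum_eq_sum_iff_of_le fun j _ => hterm j).1
    (le_antisymm (Finset.sum_le_sum fun j _ => hterm j) h1)
  funext j
  have h2 := mul_left_cancel₀ (by exact_mod_cast (hpos j).ne') (heq j (Finset.mem_univ j))
  simp only [exponent] at h2
  exact_mod_cast h2

/-- The principal part is a finite sum. -/
theorem finite_newtonDiagram_indices (F : (Fin m → ℂ) → ℝ) :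
    {q : (Fin m → ℕ) × (Fin m → ℕ) | taylorCoeff F q.1 q.2 ≠ 0 ∧
      exponent q.1 q.2 ∈ newtonDiagram F}.Finite := by
  set S := {q : (Fin m → ℕ) × (Fin m → ℕ) | taylorCoeff F q.1 q.2 ≠ 0 ∧
    exponent q.1 q.2 ∈ newtonDiagram F}
  -- By minimality the exponents on the diagram are pairwise incomparable, and Dickson's lemma makes
  -- antichains in `ℕ^m` finite.
  have hanti : IsAntichain (· ≤ ·) ((fun q : (Fin m → ℕ) × (Fin m → ℕ) => q.1 + q.2) '' S) := by
    rintro _ ⟨q, hq, rfl⟩ _ ⟨q', hq', rfl⟩ hne hle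
    exact hne (eq_of_le_of_mem_newtonDiagram hq'.1 hq'.2 hq.1 hle)
  have hfin : ((fun q : (Fin m → ℕ) × (Fin m → ℕ) => q.1 + q.2) '' S).Finite :=
    hanti.finite_of_partiallyWellOrderedOn (Set.isPWO_of_wellQuasiOrderedLE _)
  refine (hfin.biUnion fun γ _ => (Set.finite_Iic γ).prod (Set.finite_Iic γ)).subset ?_
  intro q hq
  exact mem_iUnion₂.2 ⟨_, ⟨q, hq, rfl⟩, fun j => by simp, fun j => by simp⟩

/-- A `finsum` with infinite support is `0` by convention; a finite `Q` containing all nonzero terms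
makes it a genuine sum. -/
theorem part_eq_sum (F : (Fin m → ℂ) → ℝ) (A : Set (Fin m → ℝ))
    (Q : Finset ((Fin m → ℕ) × (Fin m → ℕ)))
    (hQ : ∀ q : (Fin m → ℕ) × (Fin m → ℕ), taylorCoeff F q.1 q.2 ≠ 0 →
      (exponent q.1 q.2 ∈ A ↔ q ∈ Q)) (z : Fin m → ℂ) :
    part F A z = ∑ q ∈ Q, taylorCoeff F q.1 q.2 * mixedMonomial q.1 q.2 z := by
  classical
  have hterm : ∀ q : (Fin m → ℕ) × (Fin m → ℕ),
      (∑ᶠ (_ : exponent q.1 q.2 ∈ A), taylorCoeff F q.1 q.2 * (∏ j, z j ^ q.1 j) *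
        ∏ j, (starRingEnd ℂ (z j)) ^ q.2 j)
      = if q ∈ Q then taylorCoeff F q.1 q.2 * mixedMonomial q.1 q.2 z else 0 := by
    intro q
    rw [finsum_eq_if, mixedMonomial, mul_assoc]
    by_cases h : taylorCoeff F q.1 q.2 = 0
    · simp [h]
    · simp only [hQ q h]
  rw [part, finsum_congr hterm, finsum_eq_sum_of_support_subset (s := Q)]
  · exact Finset.sum_congr rfl fun q hq => if_pos hq
  · intro q hq
    by_contra h
    exact hq (if_neg h)

theorem mixedMonomial_mul (α β : Fin m → ℕ) (u z : Fin m → ℂ) :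
    mixedMonomial α β (fun j => u j * z j) = mixedMonomial α β u * mixedMonomial α β z := by
  simp only [mixedMonomial, map_mul, mul_pow, Finset.prod_mul_distrib]
  ring

/-- A rotation invariant principal part contains only the monomials `z^α z̄^α`. -/
theorem eq_of_isRotationInvariant {F : (Fin m → ℂ) → ℝ}
    (hrot : IsRotationInvariant (principalPart F)) {α β : Fin m → ℕ}
    (h : taylorCoeff F α β ≠ 0) (hmem : exponent α β ∈ newtonDiagram F) : α = β := by
  set Q := (finite_newtonDiagram_indices F).toFinset with hQ
  have hpart : ∀ z, principalPart F z
      = ∑ q ∈ Q, taylorCoeff F q.1 q.2 * mixedMonomial q.1 q.2 z :=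
    part_eq_sum F _ Q fun q hq => by simp [hQ, hq]
  -- A rotation multiplies each monomial by its value at `e^{iθ}`. Comparing coefficients forces
  -- this factor to be `1` for every monomial present.
  have hone : ∀ θ : Fin m → ℝ,
      mixedMonomial α β (fun j => Complex.exp (Complex.I * (θ j : ℂ))) = 1 := by
    intro θ
    have h1 := coeff_eq_zero_of_sum_mixedMonomial_eq_zero Q (fun q => taylorCoeff F q.1 q.2 *
      (mixedMonomial q.1 q.2 (fun j => Complex.exp (Complex.I * (θ j : ℂ))) - 1)) (fun z => by
        have h2 := hrot θ z
        rw [hpart, hpart] at h2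
        rw [← sub_eq_zero.2 h2, ← Finset.sum_sub_distrib]
        refine Finset.sum_congr rfl fun q _ => ?_
        rw [mixedMonomial_mul]
        ring) (α, β) (by simp [hQ, h, hmem])
    exact sub_eq_zero.1 ((mul_eq_zero.1 h1).resolve_left h)
  funext j
  by_contra hne
  have hne' : (α j : ℂ) - β j ≠ 0 := sub_ne_zero.2 (by exact_mod_cast hne)
  -- This angle in the `j`-th variable alone makes the factor `exp(i θ_j (α_j - β_j))` equal to
  -- `exp(i π) = -1`.
  have h1 := hone (Pi.single j (Real.pi / ((α j : ℝ) - β j)))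
  rw [mixedMonomial, Finset.prod_eq_single j (fun i _ hi => by simp [hi]) (by simp),
    Finset.prod_eq_single j (fun i _ hi => by simp [hi]) (by simp), Pi.single_eq_same,
    ← Complex.exp_conj, ← Complex.exp_nat_mul, ← Complex.exp_nat_mul, ← Complex.exp_add] at h1
  have h2 : (α j : ℂ) * (Complex.I * ((Real.pi / ((α j : ℝ) - β j) : ℝ) : ℂ)) +
      β j * starRingEnd ℂ (Complex.I * ((Real.pi / ((α j : ℝ) - β j) : ℝ) : ℂ))
      = Real.pi * Complex.I := by
    rw [map_mul, Complex.conj_I, Complex.conj_ofReal]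
    push_cast
    field_simp
    ring
  rw [h2, Complex.exp_pi_mul_I] at h1
  norm_num at h1

/-- On a nonempty face determined by a positive vector, `F_κ` is the part of lowest weight. -/
theorem part_eq_weightedPart {F : (Fin m → ℂ) → ℝ} {a : Fin m → ℕ} (ha : ∀ j, 1 ≤ a j) {l : ℕ}
    {κ : Set (Fin m → ℝ)} (h : CutsOut (newtonPolyhedron F) (fun j => (a j : ℤ)) l κ)
    (z : Fin m → ℂ) : part F κ z = weightedPart F a l z := by
  refine part_eq_sum F κ _ (fun q hq => ?_) z
  rw [h.2, mem_ofPred_eq, sum_mul_exponent, Finset.mem_filter]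
  constructor
  · rintro ⟨-, h1⟩
    have h2 : weight a q.1 q.2 = l := by exact_mod_cast h1
    exact ⟨mem_indexBox_of_weight_le ha h2.le, h2⟩
  · rintro ⟨-, h1⟩
    exact ⟨exponent_mem_newtonPolyhedron hq, by rw [h1]⟩

end NewtonPolyhedron

/-! ### Restriction to `w = 0` and the terms involving `w`. -/

section Hypersurface

variable {n : ℕ}

/-- The embedding `z ↦ (z, 0)`. -/
noncomputable def inclusion (n : ℕ) : (Fin n → ℂ) →L[ℝ] (Fin (n + 1) → ℂ) :=
  LinearMap.toContinuousLinearMap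
    { toFun := fun z => Fin.snoc (α := fun _ => ℂ) z 0
      map_add' := fun x y => by
        funext j
        induction j using Fin.lastCases <;> simp
      map_smul' := fun c x => by
        funext j
        induction j using Fin.lastCases <;> simp }

theorem inclusion_apply (z : Fin n → ℂ) :
    inclusion n z = Fin.snoc (α := fun _ => ℂ) z 0 := rfl

theorem inclusion_single (j : Fin n) (v : ℂ) :
    inclusion n (Pi.single j v) = Pi.single j.castSucc v := by
  rw [inclusion_apply]
  funext i
  induction i using Fin.lastCases with
  | last => simp [(Fin.castSucc_lt_last j).ne']
  | cast i =>
    rw [Fin.snoc_castSucc]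
    by_cases h : i = j
    · subst h; simp
    · rw [Pi.single_eq_of_ne h, Pi.single_eq_of_ne (by simpa using h)]

/-- The multi-index `(α, 0)`. -/
def extendIndex (α : Fin n → ℕ) : Fin (n + 1) → ℕ := Fin.snoc (α := fun _ => ℕ) α 0

theorem extendIndex_castSucc (α : Fin n → ℕ) (j : Fin n) : extendIndex α j.castSucc = α j := by
  simp [extendIndex]

theorem extendIndex_last (α : Fin n → ℕ) : extendIndex α (Fin.last n) = 0 := by
  simp [extendIndex]

theorem extendIndex_add_single (α : Fin n → ℕ) (j : Fin n) :
    extendIndex (α + Pi.single j 1) = extendIndex α + Pi.single j.castSucc 1 := by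
  funext i
  induction i using Fin.lastCases with
  | last => simp [extendIndex_last, (Fin.castSucc_lt_last j).ne']
  | cast i =>
    rw [extendIndex_castSucc, Pi.add_apply, Pi.add_apply, extendIndex_castSucc]
    by_cases h : i = j
    · subst h; simp
    · rw [Pi.single_eq_of_ne h, Pi.single_eq_of_ne (by simpa using h)]

theorem extendIndex_zero : extendIndex (0 : Fin n → ℕ) = 0 := by
  funext i
  induction i using Fin.lastCases with
  | last => simp [extendIndex_last]
  | cast i => simp [extendIndex_castSucc]

theorem extendIndex_init {α : Fin (n + 1) → ℕ} (h : α (Fin.last n) = 0) :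
    extendIndex (fun j => α j.castSucc) = α := by
  funext i
  induction i using Fin.lastCases with
  | last => rw [extendIndex_last, h]
  | cast i => rw [extendIndex_castSucc]

theorem wirtingerOp_comp_inclusion (σ : ℂ) (j : Fin n) {f : (Fin (n + 1) → ℂ) → ℂ}
    (hf : ContDiffAt ℝ ∞ f 0) :
    wirtingerOp σ j (fun z => f (inclusion n z))
      =ᶠ[𝓝 0] fun z => wirtingerOp σ j.castSucc f (inclusion n z) := by
  have h : ∀ᶠ ζ in 𝓝 (inclusion n 0), DifferentiableAt ℝ f ζ := by
    rw [map_zero]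
    filter_upwards [(contDiffAt_infty.1 hf 1).eventually (by simp)] with z hz
    exact hz.differentiableAt (by simp)
  filter_upwards [(inclusion n).continuous.continuousAt.eventually h] with z hz
  have h1 : fderiv ℝ (fun z => f (inclusion n z)) z
      = (fderiv ℝ f (inclusion n z)).comp (inclusion n) :=
    (hz.hasFDerivAt.comp z (inclusion n).hasFDerivAt).fderiv
  simp only [wirtingerOp, h1, ContinuousLinearMap.comp_apply, inclusion_single]

theorem jet_comp_inclusion (α β : Fin n → ℕ) {f : (Fin (n + 1) → ℂ) → ℂ}
    (hf : ContDiffAt ℝ ∞ f 0) :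
    jet α β (fun z => f (inclusion n z)) = jet (extendIndex α) (extendIndex β) f := by
  have hcomp : ∀ {f : (Fin (n + 1) → ℂ) → ℂ}, ContDiffAt ℝ ∞ f 0 →
      ContDiffAt ℝ ∞ (fun z => f (inclusion n z)) 0 := fun {f} hf =>
    ContDiffAt.comp (g := f) (f := inclusion n) 0 (by rwa [map_zero])
      (inclusion n).contDiff.contDiffAt
  refine multiIndex_induction (P := fun α β => ∀ f : (Fin (n + 1) → ℂ) → ℂ,
    ContDiffAt ℝ ∞ f 0 → jet α β (fun z => f (inclusion n z))
      = jet (extendIndex α) (extendIndex β) f) ?_ ?_ ?_ α β f hf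
  · intro f _
    rw [extendIndex_zero, jet_zero, jet_zero, map_zero]
  · intro α β j ih f hf
    rw [jet_add_single_left _ _ _ (hcomp hf), extendIndex_add_single,
      jet_add_single_left _ _ _ hf, ← ih _ ((germLinear_wirtinger _).smooth hf)]
    refine jet_congr _ _ ?_
    simp only [wirtinger_eq]
    exact wirtingerOp_comp_inclusion _ j hf
  · intro α β j ih f hf
    rw [jet_add_single_right _ _ _ (hcomp hf), extendIndex_add_single,
      jet_add_single_right _ _ _ hf, ← ih _ ((germLinear_wirtingerBar _).smooth hf)]
    refine jet_congr _ _ ?_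
    simp only [wirtingerBar_eq]
    exact wirtingerOp_comp_inclusion _ j hf

/-- Derivatives in the `z` variables commute with restriction to `w = 0`, so the Taylor terms of `r`
free of `w` are exactly those of `F`. -/
theorem taylorCoeff_extendIndex {r : (Fin (n + 1) → ℂ) → ℝ} {F : (Fin n → ℂ) → ℝ}
    (hr : SmoothGerm r 0) (hF : (fun z => r (inclusion n z)) =ᶠ[𝓝 0] F) (α β : Fin n → ℕ) :
    taylorCoeff r (extendIndex α) (extendIndex β) = taylorCoeff F α β := by
  rw [taylorCoeff_eq, taylorCoeff_eq, ← jet_comp_inclusion α β hr.contDiffAt_ofReal]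
  congr 1
  · simp [Fin.prod_univ_castSucc, extendIndex_castSucc, extendIndex_last]
  · refine jet_congr _ _ ?_
    filter_upwards [hF] with z hz
    rw [hz]

theorem weight_extendIndex (a : Fin (n + 1) → ℕ) (α β : Fin n → ℕ) :
    weight a (extendIndex α) (extendIndex β) = weight (fun j => a j.castSucc) α β := by
  simp [weight, Fin.sum_univ_castSucc, extendIndex_castSucc, extendIndex_last]

theorem mixedMonomial_extendIndex (α β : Fin n → ℕ) (ζ : Fin (n + 1) → ℂ) :
    mixedMonomial (extendIndex α) (extendIndex β) ζ
      = mixedMonomial α β (fun j => ζ j.castSucc) := by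
  simp [mixedMonomial, Fin.prod_univ_castSucc, extendIndex_castSucc, extendIndex_last]

theorem factorial_single {m : ℕ} (j : Fin m) :
    ∏ k, (((Pi.single j 1 : Fin m → ℕ) k).factorial : ℂ) = 1 := by
  refine Finset.prod_eq_one fun k _ => ?_
  by_cases h : k = j
  · subst h; simp
  · simp [h]

theorem fderiv_ofReal_apply {m : ℕ} {r : (Fin m → ℂ) → ℝ} (hr : SmoothGerm r 0)
    (v : Fin m → ℂ) :
    fderiv ℝ (fun z => (r z : ℂ)) 0 v = ((fderiv ℝ r 0 v : ℝ) : ℂ) := by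
  obtain ⟨U, hU, h0, h⟩ := hr
  have h1 := ((h.contDiffAt (hU.mem_nhds h0)).differentiableAt (by simp)).hasFDerivAt
  have h2 : HasFDerivAt (fun z => (r z : ℂ)) (Complex.ofRealCLM.comp (fderiv ℝ r 0)) 0 :=
    Complex.ofRealCLM.hasFDerivAt.comp _ h1
  rw [h2.fderiv]
  rfl

theorem taylorCoeff_single_left {m : ℕ} {r : (Fin m → ℂ) → ℝ} (hr : SmoothGerm r 0)
    (j : Fin m) : taylorCoeff r (Pi.single j 1) 0
      = (1 / 2 : ℂ) * ((fderiv ℝ r 0 (Pi.single j 1) : ℝ)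
        - Complex.I * (fderiv ℝ r 0 (Pi.single j Complex.I) : ℝ)) := by
  have h := jet_add_single_left 0 0 j hr.contDiffAt_ofReal
  rw [zero_add, jet_zero] at h
  rw [taylorCoeff_eq, h, wirtinger, fderiv_ofReal_apply hr, fderiv_ofReal_apply hr,
    factorial_single]
  simp

theorem taylorCoeff_single_right {m : ℕ} {r : (Fin m → ℂ) → ℝ} (hr : SmoothGerm r 0)
    (j : Fin m) : taylorCoeff r 0 (Pi.single j 1)
      = starRingEnd ℂ (taylorCoeff r (Pi.single j 1) 0) := by
  have h := jet_add_single_right 0 0 j hr.contDiffAt_ofReal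
  rw [zero_add, jet_zero] at h
  rw [taylorCoeff_single_left hr, taylorCoeff_eq, h, wirtingerBar, fderiv_ofReal_apply hr,
    fderiv_ofReal_apply hr, factorial_single]
  simp
  exact Or.inl (map_ofNat (starRingEnd ℂ) 2).symm

section Normalized

variable {p : Fin (n + 1) → ℂ} {M : Set (Fin (n + 1) → ℂ)} {Z : HolomorphicCoordinate p}
  {N : ℕ} {r : (Fin (n + 1) → ℂ) → ℝ} {F R₁ : (Fin n → ℂ) → ℝ} {R₂ : (Fin (n + 1) → ℂ) → ℝ}

/-- At `w = 0` the `Im w` term drops out, and the quadratic bound forces `R₂ = 0`. -/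
theorem IsNormalized.comp_inclusion (hZ : IsNormalized M Z N r F R₁ R₂) :
    (fun z => r (inclusion n z)) =ᶠ[𝓝 0] F := by
  obtain ⟨C, -, hC⟩ := hZ.R₂_bound
  have ht : Tendsto (inclusion n) (𝓝 0) (𝓝 0) := by
    simpa using (inclusion n).continuous.tendsto 0
  filter_upwards [ht.eventually hZ.expression, ht.eventually hC] with z h1 h2
  have hlast : inclusion n z (Fin.last n) = 0 := by simp [inclusion_apply]
  have hinit : Fin.init (α := fun _ => ℂ) (inclusion n z) = z := by
    rw [inclusion_apply, Fin.init_snoc]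
  have hR : R₂ (inclusion n z) = 0 := by
    rw [hlast] at h2
    simpa using h2
  rw [h1, hlast, hinit, hR]
  simp

/-- Along the real axis of `w` with `z = 0`, the normal form reads `r = t + O(t²)`. -/
theorem IsNormalized.fderiv_last (hZ : IsNormalized M Z N r F R₁ R₂) :
    fderiv ℝ r 0 (Pi.single (Fin.last n) 1) = 1 := by
  obtain ⟨C, -, hC⟩ := hZ.R₂_bound
  set e : Fin (n + 1) → ℂ := Pi.single (Fin.last n) 1 with he
  obtain ⟨U, hU, h0, h⟩ := hZ.defining.1
  have hr : HasFDerivAt r (fderiv ℝ r 0) ((0 : ℝ) • e) := by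
    rw [zero_smul]
    exact ((h.contDiffAt (hU.mem_nhds h0)).differentiableAt (by simp)).hasFDerivAt
  have h1 : HasDerivAt (fun t : ℝ => r (t • e)) (fderiv ℝ r 0 e) 0 := by
    have h2 : HasDerivAt (fun t : ℝ => t • e) ((1 : ℝ) • e) 0 :=
      (hasDerivAt_id (0 : ℝ)).smul_const e
    rw [one_smul] at h2
    exact hr.comp_hasDerivAt (0 : ℝ) h2
  have ht : Tendsto (fun t : ℝ => t • e) (𝓝 0) (𝓝 0) := by
    have : Continuous fun t : ℝ => t • e := by fun_prop
    simpa using this.tendsto 0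
  have hO : (fun t : ℝ => r (t • e) - t) =O[𝓝 0] fun t : ℝ => ‖t - 0‖ ^ 2 := by
    refine Asymptotics.IsBigO.of_bound C ?_
    filter_upwards [ht.eventually hZ.expression, ht.eventually hC] with t h3 h4
    have hlast : (t • e) (Fin.last n) = (t : ℂ) := by simp [he]
    have hinit : Fin.init (α := fun _ => ℂ) (t • e) = 0 := by
      funext j
      simp [Fin.init, he, (Fin.castSucc_lt_last j).ne]
    rw [hlast, Complex.norm_real] at h4
    rw [h3, hlast, hinit, hZ.F_zero]
    simpa using h4
  have h5 := hO.hasFDerivAt (𝕜 := ℝ) (by norm_num)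
  have h6 : HasDerivAt (fun t : ℝ => r (t • e) - t) 0 0 := h5.hasDerivAt
  have h7 := h6.add (hasDerivAt_id (0 : ℝ))
  have h8 : ((fun t : ℝ => r (t • e) - t) + id) = fun t : ℝ => r (t • e) := by
    funext t
    simp
  rw [h8] at h7
  simpa using h1.unique h7

/-- Its real part is `1/2`. The resulting exponent caps the lowest weight of `r` by the weight of
`w`. -/
theorem IsNormalized.taylorCoeff_last_ne_zero (hZ : IsNormalized M Z N r F R₁ R₂) :
    taylorCoeff r (Pi.single (Fin.last n) 1) 0 ≠ 0 := by
  intro h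
  rw [taylorCoeff_single_left hZ.defining.1, hZ.fderiv_last] at h
  have := congrArg Complex.re h
  simp at this

theorem weight_castSucc_add_last (a α β : Fin (n + 1) → ℕ) :
    weight a α β = weight (fun j => a j.castSucc) (fun j => α j.castSucc)
      (fun j => β j.castSucc) + a (Fin.last n) * (α (Fin.last n) + β (Fin.last n)) := by
  simp [weight, Fin.sum_univ_castSucc]

theorem last_le_weight {a α β : Fin (n + 1) → ℕ}
    (h : ¬ (α (Fin.last n) = 0 ∧ β (Fin.last n) = 0)) : a (Fin.last n) ≤ weight a α β := by
  rw [weight_castSucc_add_last]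
  have : 1 ≤ α (Fin.last n) + β (Fin.last n) := by omega
  nlinarith [Nat.mul_le_mul_left (a (Fin.last n)) this]

/-- The terms of weight `l` that do not involve the last coordinate. -/
theorem sum_weight_last_eq_zero (hr : SmoothGerm r 0)
    (hF : (fun z => r (inclusion n z)) =ᶠ[𝓝 0] F) (a : Fin (n + 1) → ℕ) (l : ℕ)
    (ζ : Fin (n + 1) → ℂ) :
    ∑ q ∈ {q ∈ indexBox (n + 1) l | weight a q.1 q.2 = l} with
        q.1 (Fin.last n) = 0 ∧ q.2 (Fin.last n) = 0,
      taylorCoeff r q.1 q.2 * mixedMonomial q.1 q.2 ζ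
      = weightedPart F (fun j => a j.castSucc) l (fun j => ζ j.castSucc) := by
  refine Finset.sum_nbij' (fun q => (fun j => q.1 j.castSucc, fun j => q.2 j.castSucc))
    (fun q => (extendIndex q.1, extendIndex q.2)) ?_ ?_ ?_ ?_ ?_
  · rintro ⟨α, β⟩ hq
    simp only [Finset.mem_filter, mem_indexBox] at hq ⊢
    refine ⟨⟨fun j => hq.1.1.1 _, fun j => hq.1.1.2 _⟩, ?_⟩
    rw [← weight_extendIndex, extendIndex_init hq.2.1, extendIndex_init hq.2.2]
    exact hq.1.2
  · rintro ⟨α, β⟩ hq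
    simp only [Finset.mem_filter, mem_indexBox] at hq ⊢
    refine ⟨⟨⟨fun j => ?_, fun j => ?_⟩, ?_⟩, extendIndex_last _, extendIndex_last _⟩
    · induction j using Fin.lastCases with
      | last => simp [extendIndex_last]
      | cast j => rw [extendIndex_castSucc]; exact hq.1.1 j
    · induction j using Fin.lastCases with
      | last => simp [extendIndex_last]
      | cast j => rw [extendIndex_castSucc]; exact hq.1.2 j
    · rw [weight_extendIndex]
      exact hq.2
  · rintro ⟨α, β⟩ hq
    simp only [Finset.mem_filter] at hq
    simp only [extendIndex_init hq.2.1, extendIndex_init hq.2.2]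
  · rintro ⟨α, β⟩ -
    simp only [extendIndex_castSucc]
  · rintro ⟨α, β⟩ hq
    simp only [Finset.mem_filter] at hq
    rw [← taylorCoeff_extendIndex hr hF, ← mixedMonomial_extendIndex]
    simp only [extendIndex_init hq.2.1, extendIndex_init hq.2.2]

theorem weightedPart_of_lt_last (hr : SmoothGerm r 0)
    (hF : (fun z => r (inclusion n z)) =ᶠ[𝓝 0] F) {a : Fin (n + 1) → ℕ} {l : ℕ}
    (hl : l < a (Fin.last n)) (ζ : Fin (n + 1) → ℂ) :
    weightedPart r a l ζ = weightedPart F (fun j => a j.castSucc) l (fun j => ζ j.castSucc) := by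
  rw [← sum_weight_last_eq_zero hr hF, weightedPart]
  congr 1
  symm
  refine Finset.filter_true_of_mem fun q hq => ?_
  by_contra h
  have := last_le_weight (a := a) h
  have := (Finset.mem_filter.1 hq).2
  omega

/-- A single factor `w` or `w̄` already uses up the whole weight, and positivity of the other
weights leaves no room for `z`. -/
theorem eq_single_of_weight_eq_last {a : Fin (n + 1) → ℕ} (ha : ∀ j, 1 ≤ a j)
    {α β : Fin (n + 1) → ℕ} (hw : weight a α β = a (Fin.last n))
    (h : ¬ (α (Fin.last n) = 0 ∧ β (Fin.last n) = 0)) :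
    (α = Pi.single (Fin.last n) 1 ∧ β = 0) ∨ (α = 0 ∧ β = Pi.single (Fin.last n) 1) := by
  rw [weight_castSucc_add_last] at hw
  have hlast := ha (Fin.last n)
  have h1 : α (Fin.last n) + β (Fin.last n) = 1 := by
    have h2 : a (Fin.last n) * (α (Fin.last n) + β (Fin.last n)) ≤ a (Fin.last n) * 1 := by omega
    have := Nat.le_of_mul_le_mul_left h2 hlast
    omega
  rw [h1, mul_one] at hw
  have h0 : ∀ j : Fin n, α j.castSucc = 0 ∧ β j.castSucc = 0 := by
    intro j
    have := weight_pos_coord (fun j : Fin n => ha j.castSucc) (fun j => α j.castSucc)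
      (fun j => β j.castSucc) j
    omega
  rcases Nat.eq_zero_or_pos (α (Fin.last n)) with h2 | h2
  · right
    constructor <;> funext j <;> induction j using Fin.lastCases with
    | last => simp; omega
    | cast j => simp [h0 j, (Fin.castSucc_lt_last j).ne]
  · left
    constructor <;> funext j <;> induction j using Fin.lastCases with
    | last => simp; omega
    | cast j => simp [h0 j, (Fin.castSucc_lt_last j).ne]

theorem weight_single_left {m : ℕ} (a : Fin m → ℕ) (j : Fin m) :
    weight a (Pi.single j 1) 0 = a j := by
  rw [weight, Finset.sum_eq_single j (fun i _ hi => by simp [hi]) (by simp)]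
  simp

theorem weight_single_right {m : ℕ} (a : Fin m → ℕ) (j : Fin m) :
    weight a 0 (Pi.single j 1) = a j := by
  rw [weight, Finset.sum_eq_single j (fun i _ hi => by simp [hi]) (by simp)]
  simp

theorem mixedMonomial_single_left {m : ℕ} (j : Fin m) (z : Fin m → ℂ) :
    mixedMonomial (Pi.single j 1) 0 z = z j := by
  rw [mixedMonomial, Finset.prod_eq_single j (fun i _ hi => by simp [hi]) (by simp)]
  simp

theorem mixedMonomial_single_right {m : ℕ} (j : Fin m) (z : Fin m → ℂ) :
    mixedMonomial 0 (Pi.single j 1) z = starRingEnd ℂ (z j) := by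
  rw [mixedMonomial, mul_comm, Finset.prod_eq_single j (fun i _ hi => by simp [hi]) (by simp)]
  simp

/-- Beyond the terms of `F` only `w` and `w̄` have this weight; `r` is real, so their coefficients
are conjugate. -/
theorem weightedPart_of_eq_last (hr : SmoothGerm r 0)
    (hF : (fun z => r (inclusion n z)) =ᶠ[𝓝 0] F) {a : Fin (n + 1) → ℕ} (ha : ∀ j, 1 ≤ a j)
    (ζ : Fin (n + 1) → ℂ) :
    weightedPart r a (a (Fin.last n)) ζ
      = weightedPart F (fun j => a j.castSucc) (a (Fin.last n)) (fun j => ζ j.castSucc)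
        + (taylorCoeff r (Pi.single (Fin.last n) 1) 0 * ζ (Fin.last n)
          + starRingEnd ℂ (taylorCoeff r (Pi.single (Fin.last n) 1) 0 * ζ (Fin.last n))) := by
  rw [← sum_weight_last_eq_zero hr hF, weightedPart, ← Finset.sum_filter_add_sum_filter_not
    {q ∈ indexBox (n + 1) (a (Fin.last n)) | weight a q.1 q.2 = a (Fin.last n)}
    fun q : (Fin (n + 1) → ℕ) × (Fin (n + 1) → ℕ) =>
      q.1 (Fin.last n) = 0 ∧ q.2 (Fin.last n) = 0]
  congr 1
  have hne : ((Pi.single (Fin.last n) 1, 0) : (Fin (n + 1) → ℕ) × (Fin (n + 1) → ℕ))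
      ≠ (0, Pi.single (Fin.last n) 1) := by
    intro h
    have := congrFun (Prod.mk.inj h).1 (Fin.last n)
    simp at this
  have hset : Finset.filter (fun q : (Fin (n + 1) → ℕ) × (Fin (n + 1) → ℕ) =>
      ¬ (q.1 (Fin.last n) = 0 ∧ q.2 (Fin.last n) = 0))
      {q ∈ indexBox (n + 1) (a (Fin.last n)) | weight a q.1 q.2 = a (Fin.last n)}
      = {(Pi.single (Fin.last n) 1, 0), (0, Pi.single (Fin.last n) 1)} := by
    ext ⟨α, β⟩
    rw [Finset.mem_filter, Finset.mem_filter, Finset.mem_insert, Finset.mem_singleton,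
      Prod.mk.injEq, Prod.mk.injEq]
    constructor
    · rintro ⟨⟨-, hw⟩, h⟩
      exact eq_single_of_weight_eq_last ha hw h
    · rintro (⟨rfl, rfl⟩ | ⟨rfl, rfl⟩)
      · have hw := weight_single_left a (Fin.last n)
        exact ⟨⟨mem_indexBox_of_weight_le ha hw.le, hw⟩, by simp⟩
      · have hw := weight_single_right a (Fin.last n)
        exact ⟨⟨mem_indexBox_of_weight_le ha hw.le, hw⟩, by simp⟩
  rw [hset, Finset.sum_pair hne, mixedMonomial_single_left, mixedMonomial_single_right,
    taylorCoeff_single_right hr, map_mul]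

/-- A defining function whose restriction `F` to `w = 0` is plurisubharmonic with rotation invariant
principal part is nondegenerate. -/
theorem IsNormalized.isNondegenerate (hZ : IsNormalized M Z N r F R₁ R₂)
    (hpsh : IsPlurisubharmonicGerm F) (hrot : IsRotationInvariant (principalPart F)) :
    IsNondegenerate r := by
  intro κ _ _ hκ c a hc ha ⟨l, hcut⟩
  obtain ⟨k, rfl, hval, α₀, β₀, h₀, hw₀⟩ := hcut.exists_weight_eq hκ
  have hr := hZ.defining.1
  have hF := hZ.comp_inclusion
  simp only [part_eq_weightedPart ha hcut]
  have ha' : ∀ j : Fin n, 1 ≤ a j.castSucc := fun j => ha _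
  have hvalF : ∀ α β, taylorCoeff F α β ≠ 0 → k ≤ weight (fun j => a j.castSucc) α β := by
    intro α β h
    rw [← weight_extendIndex]
    exact hval _ _ (by rwa [taylorCoeff_extendIndex hr hF])
  have hdiag : ∀ α β, taylorCoeff F α β ≠ 0 → weight (fun j => a j.castSucc) α β = k → α = β :=
    fun α β h hw => eq_of_isRotationInvariant hrot h (exponent_mem_newtonDiagram ha' hvalF h hw)
  have hC := hZ.taylorCoeff_last_ne_zero
  have hk : k ≤ a (Fin.last n) := by
    have := hval _ _ hC
    rwa [weight_single_left] at this
  rcases hk.lt_or_eq with hlt | rfl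
  -- Any nonzero `t` would do, since the lowest weight part of `F` has no zero off the coordinate
  -- hyperplanes.
  · refine ⟨1, ?_⟩
    simp only [one_pow, mul_one]
    have h1 : α₀ (Fin.last n) = 0 ∧ β₀ (Fin.last n) = 0 := by
      by_contra h
      have := last_le_weight (a := a) h
      omega
    rw [weightedPart_of_lt_last hr hF hlt]
    refine weightedPart_ne_zero hZ.smooth_F hZ.F_zero hpsh ha' hvalF hdiag
      (α := fun j => α₀ j.castSucc) (β := fun j => β₀ j.castSucc) ?_ ?_ fun j => hc _
    · rwa [← taylorCoeff_extendIndex hr hF, extendIndex_init h1.1, extendIndex_init h1.2]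
    · rwa [← weight_extendIndex, extendIndex_init h1.1, extendIndex_init h1.2]
  · have hpos := ha (Fin.last n)
    set L := a (Fin.last n) with hL
    set b := taylorCoeff r (Pi.single (Fin.last n) 1) 0 * c (Fin.last n) with hb
    have hb0 : b ≠ 0 := mul_ne_zero hC (hc _)
    -- This choice turns `b t₀^L` into `|b|²`, and passing to `η t₀` turns it into `-|b|²`.
    obtain ⟨t₀, ht₀⟩ := IsAlgClosed.exists_pow_nat_eq (starRingEnd ℂ b) hpos
    obtain ⟨η, hη⟩ := IsAlgClosed.exists_pow_nat_eq (-1 : ℂ) hpos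
    have hηnorm : ‖η‖ = 1 := by
      have h1 : ‖η‖ ^ L = 1 := by rw [← norm_pow, hη, norm_neg, norm_one]
      exact (pow_eq_one_iff_of_nonneg (norm_nonneg _) (by omega)).1 h1
    by_contra! hall
    have key : ∀ t : ℂ, weightedPart F (fun j => a j.castSucc) L
        (fun j => c j.castSucc * t ^ a j.castSucc) + (b * t ^ L + starRingEnd ℂ (b * t ^ L))
        = 0 := by
      intro t
      rw [← hall t, weightedPart_of_eq_last hr hF ha]
      simp only [hb, hL, mul_assoc]
    have h1 := key t₀
    have h2 := key (η * t₀)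
    -- The root `η` has modulus `1`, so it does not change the moduli on which the diagonal sum
    -- depends.
    have h3 : weightedPart F (fun j => a j.castSucc) L
        (fun j => c j.castSucc * (η * t₀) ^ a j.castSucc)
        = weightedPart F (fun j => a j.castSucc) L
        (fun j => c j.castSucc * t₀ ^ a j.castSucc) := by
      rw [weightedPart_eq_sum_diagonal hdiag, weightedPart_eq_sum_diagonal hdiag]
      simp only [norm_mul, norm_pow, hηnorm, one_mul]
    rw [h3, mul_pow, hη, ht₀] at h2
    rw [ht₀] at h1
    simp only [map_mul, map_neg, map_one, Complex.conj_conj] at h1 h2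
    have h4 : b * starRingEnd ℂ b = 0 := by linear_combination (h1 - h2) / 4
    exact hb0 (by simpa using h4)

end Normalized

end Hypersurface

end NewtonType

theorem theorem13p1 (n : ℕ) (M : Set (Fin (n + 1) → ℂ)) (p : Fin (n + 1) → ℂ)
    (hp : p ∈ M) (hM : NewtonType.IsRealHypersurfaceAt M p)
    (Z : NewtonType.HolomorphicCoordinate p) (N : ℕ) (r : (Fin (n + 1) → ℂ) → ℝ)
    (F R₁ : (Fin n → ℂ) → ℝ) (R₂ : (Fin (n + 1) → ℂ) → ℝ)
    (hZ : NewtonType.IsNormalized M Z N r F R₁ R₂)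
    (hflat : ¬ NewtonType.IsFlat F)
    (hpsh : NewtonType.IsPlurisubharmonicGerm F)
    (hrot : NewtonType.IsRotationInvariant (NewtonType.principalPart F)) :
    NewtonType.IsCanonical M Z :=
  ⟨r, hZ.defining, hZ.isNondegenerate hpsh hrot⟩
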